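/- Let $m,n$ be nonzero integers and let $K=J(2m,2n)$ be the genus one two-bridge knot (double twist knot with $2m$ and $2n$ half twists), with knot group given by the presentation $$\pi_1(K)=\langle a,b\mid w^na=bw^n\rangle,\qquad w=(ba^{-1})^m(b^{-1}a)^m,$$ where $a,b$ are meridians. Let $\rho:\pi_1(K)\to SL_2(\mathbb C)$ be a nonabelian representation (its image is a nonabelian group), and put $x=\operatorname{tr}\rho(a)$, $y=\operatorname{tr}\rho(ab^{-1})$. (For $\rho$ in Riley normal form, $\rho(a)=\begin{pmatrix}s&1\\0&s^{-1}\end{pmatrix}$, $\rho(b)=\begin{pmatrix}s&0\\2-y&s^{-1}\end{pmatrix}$, this is $x=s+s^{-1}$ and the same $y$.) Let $\mathrm{Ad}_M(g)=MgM^{-1}$ be the adjoint action of $SL_2(\mathbb C)$ on $sl_2(\mathbb C)\cong\mathbb C^3$, let $\Phi$ be the ring homomorphism from the integral group ring of the free group on $a,b$ to the $3\times3$ matrices over $\mathbb C[t^{\pm1}]$ that sends $a\mapsto t\,\mathrm{Ad}_{\rho(a)}$, $b\mapsto t\,\mathrm{Ad}_{\rho(b)}$, and let $r=w^naw^{-n}b^{-1}$.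 With Fox derivatives put $$\Delta_a(t)=\frac{\det\Phi(\partial r/\partial b)}{\det\Phi(1-a)},\qquad \Delta_b(t)=\frac{\det\Phi(\partial r/\partial a)}{\det\Phi(1-b)};$$ each of these represents the adjoint twisted Alexander polynomial $\Delta_K^{\mathrm{Ad}\circ\rho}(t)$, which is defined up to sign and up to a factor $t^{3k}$, $k\in\mathbb Z$. Let $S_k$ ($k\in\mathbb Z$) be the Chebyshev polynomials $S_0(v)=1$, $S_1(v)=v$, $S_k(v)=vS_{k-1}(v)-S_{k-2}(v)$, and let $$A=2n\,\frac{2m+2S_m(y)S_{m-1}(y)-yS_{m-1}^2(y)}{y+2},$$ $$\begin{aligned}B={}&-4\big(S_m(y)+S_{m-1}(y)\big)^2\,\frac{mS_m(y)+(m+1)S_{m-1}(y)}{(y+2)S_{m-1}(y)}+6mS_m^2(y)\\&+(4+4m-4n-2my)S_m(y)S_{m-1}(y)+(2+2m-4mn-y+2ny+2mny)S_{m-1}^2(y),\end{aligned}$$ $$C=-(2mn-1)\big(2S_m(y)-yS_{m-1}(y)\big)^2 .$$ Suppose that $y\neq-2$ and $4+(y-2)(y+2-x^2)S_{m-1}^2(y)\neq0$.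 Then $S_{m-1}(y)$, $y+2-x^2$ and $4-x^2+(y-2)(y+2-x^2)S_{m-1}^2(y)$ are nonzero as well, so that every denominator in the following formula is nonzero, and $$\Delta_K^{\mathrm{Ad}\circ\rho}(t)=\frac{t-1}{(y+2-x^2)\big(4-x^2+(y-2)(y+2-x^2)S_{m-1}^2(y)\big)}\left(mn\,t^2-\frac{Ax^4+Bx^2+C}{4+(y-2)(y+2-x^2)S_{m-1}^2(y)}\,t+mn\right).$$ Precisely, if $R(t)$ denotes the right-hand side, there is $k\in\mathbb Z$ with $\Delta_a(t)=t^{3k}R(t)$ and $\Delta_b(t)=-t^{3k}R(t)$. -/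

import Mathlib

open scoped MatrixGroups

noncomputable section

namespace TwistedAlexander

/-! ## Fox derivatives -/

/-- Left multiplication of the free group `F` on (the additive group of) its integral group ring
`ℤ[F]`, as an action by automorphisms. -/
def foxAct (α : Type*) :
    FreeGroup α →* MulAut (Multiplicative (MonoidAlgebra ℤ (FreeGroup α))) where
  toFun g :=
    { toFun := fun v => Multiplicative.ofAdd (MonoidAlgebra.of ℤ (FreeGroup α) g * v.toAdd)
      invFun := fun v => Multiplicative.ofAdd (MonoidAlgebra.of ℤ (FreeGroup α) g⁻¹ * v.toAdd)
      left_inv := fun v => by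
        beta_reduce
        rw [toAdd_ofAdd, ← mul_assoc, ← map_mul, inv_mul_cancel, map_one, one_mul, ofAdd_toAdd]
      right_inv := fun v => by
        beta_reduce
        rw [toAdd_ofAdd, ← mul_assoc, ← map_mul, mul_inv_cancel, map_one, one_mul, ofAdd_toAdd]
      map_mul' := fun v w => by rw [toAdd_mul, mul_add, ofAdd_add] }
  map_one' := by
    ext v
    simp
  map_mul' g h := by
    ext v
    simp [mul_assoc]

/-- The homomorphism `u ↦ (∂u/∂xⱼ, u)` from the free group to `ℤ[F] ⋊ F`. Its being a homomorphism
is the product rule for Fox derivatives. -/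
def foxHom {α : Type*} [DecidableEq α] (j : α) :
    FreeGroup α →*
      Multiplicative (MonoidAlgebra ℤ (FreeGroup α)) ⋊[foxAct α] FreeGroup α :=
  FreeGroup.lift fun i => ⟨Multiplicative.ofAdd (if i = j then 1 else 0), FreeGroup.of i⟩

/-- The Fox derivative `∂u/∂xⱼ` in the integral group ring of the free group. -/
def foxDeriv {α : Type*} [DecidableEq α] (j : α) (u : FreeGroup α) :
    MonoidAlgebra ℤ (FreeGroup α) :=
  (foxHom j u).left.toAdd

theorem foxDeriv_of {α : Type*} [DecidableEq α] (j i : α) :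
    foxDeriv j (FreeGroup.of i) = if i = j then 1 else 0 := by
  simp [foxDeriv, foxHom]

theorem foxHom_right {α : Type*} [DecidableEq α] (j : α) (u : FreeGroup α) :
    (foxHom j u).right = u := by
  have h : (SemidirectProduct.rightHom.comp (foxHom j)) = MonoidHom.id (FreeGroup α) := by
    ext i
    simp [foxHom]
  exact DFunLike.congr_fun h u

theorem foxDeriv_mul {α : Type*} [DecidableEq α] (j : α) (u v : FreeGroup α) :
    foxDeriv j (u * v) =
      foxDeriv j u + MonoidAlgebra.of ℤ (FreeGroup α) u * foxDeriv j v := by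
  simp only [foxDeriv, map_mul, SemidirectProduct.mul_left, foxHom_right, toAdd_mul]
  rfl

/-! ## The twisted Alexander invariant of a presentation of deficiency one -/

/-- The group `⟨a₀, …, a_ℓ | r₁, …, r_ℓ⟩`. -/
abbrev PresGroup {l : ℕ} (r : Fin l → FreeGroup (Fin (l + 1))) : Type :=
  PresentedGroup (Set.range r)

/-- For a homomorphism `f : G → ℤ` and a matrix representation `τ` of `G` over `ℂ`, the
representation `g ↦ t ^ f(g) • τ(g)` of `G` over `ℂ(t) ⊇ ℂ[t, t⁻¹]`. -/
def twist {G : Type*} [Group G] {κ : Type*} [Fintype κ] [DecidableEq κ]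
    (f : G →* Multiplicative ℤ) (τ : G →* Matrix κ κ ℂ) :
    G →* Matrix κ κ (RatFunc ℂ) where
  toFun g := (RatFunc.X ^ (f g).toAdd : RatFunc ℂ) • (τ g).map RatFunc.C
  map_one' := by simp [Matrix.map_one]
  map_mul' g h := by
    rw [map_mul f, map_mul τ, toAdd_mul, zpow_add₀ RatFunc.X_ne_zero, Matrix.map_mul,
      Matrix.smul_mul, Matrix.mul_smul, smul_smul]

/-- The ring homomorphism `Φ` from the group ring of the free group to matrices over `ℂ(t)`
induced by the presentation, `f` and `τ`. -/
def Phi {l : ℕ} (r : Fin l → FreeGroup (Fin (l + 1))) {κ : Type*} [Fintype κ] [DecidableEq κ]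
    (f : PresGroup r →* Multiplicative ℤ) (τ : PresGroup r →* Matrix κ κ ℂ) :
    MonoidAlgebra ℤ (FreeGroup (Fin (l + 1))) →ₐ[ℤ] Matrix κ κ (RatFunc ℂ) :=
  MonoidAlgebra.lift ℤ (Matrix κ κ (RatFunc ℂ)) (FreeGroup (Fin (l + 1)))
    ((twist f τ).comp (PresentedGroup.mk (Set.range r)))

/-- The matrix `M_j`: the block matrix `(Φ(∂rᵢ/∂aₖ))` with its `j`-th block column removed. -/
def foxMatrix {l : ℕ} (r : Fin l → FreeGroup (Fin (l + 1))) {κ : Type*} [Fintype κ]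
    [DecidableEq κ] (f : PresGroup r →* Multiplicative ℤ) (τ : PresGroup r →* Matrix κ κ ℂ)
    (j : Fin (l + 1)) : Matrix (Fin l × κ) (Fin l × κ) (RatFunc ℂ) :=
  Matrix.of fun p q => Phi r f τ (foxDeriv (j.succAbove q.1) (r p.1)) p.2 q.2

/-- Wada's twisted Alexander quotient `det M_j / det Φ(1 - aⱼ)`. -/
def wada {l : ℕ} (r : Fin l → FreeGroup (Fin (l + 1))) {κ : Type*} [Fintype κ]
    [DecidableEq κ] (f : PresGroup r →* Multiplicative ℤ) (τ : PresGroup r →* Matrix κ κ ℂ)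
    (j : Fin (l + 1)) : RatFunc ℂ :=
  (foxMatrix r f τ j).det /
    (Phi r f τ (1 - MonoidAlgebra.of ℤ (FreeGroup (Fin (l + 1))) (FreeGroup.of j))).det

/-! ## The adjoint representation -/

/-- The Lie algebra `sl₂(ℂ)` of trace zero matrices. -/
abbrev sl2 : Type := LieAlgebra.SpecialLinear.sl (Fin 2) ℂ

theorem mem_sl2 (g : Matrix (Fin 2) (Fin 2) ℂ) :
    g ∈ LieAlgebra.SpecialLinear.sl (Fin 2) ℂ ↔ g.trace = 0 := Iff.rfl

/-- The adjoint action `Ad_A(g) = A g A⁻¹` of `SL₂(ℂ)` on `sl₂(ℂ)`. -/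
def Ad : SL(2, ℂ) →* Module.End ℂ sl2 where
  toFun A :=
    { toFun := fun g => ⟨A.1 * g.1 * (A⁻¹).1, by
        rw [mem_sl2, Matrix.trace_mul_comm, ← mul_assoc, ← Matrix.SpecialLinearGroup.coe_mul,
          inv_mul_cancel, Matrix.SpecialLinearGroup.coe_one, one_mul]
        exact g.2⟩
      map_add' := fun g h => Subtype.ext (by
        change A.1 * (g.1 + h.1) * (A⁻¹).1 = A.1 * g.1 * (A⁻¹).1 + A.1 * h.1 * (A⁻¹).1
        rw [mul_add, add_mul])
      map_smul' := fun c g => Subtype.ext (by simp) }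
  map_one' := by
    refine LinearMap.ext fun g => Subtype.ext ?_
    simp
  map_mul' A B := by
    refine LinearMap.ext fun g => Subtype.ext ?_
    simp [mul_assoc]

/-- Coordinates with respect to the basis `E, H, F` of `sl₂(ℂ)`: the matrix `!![h, e; f, -h]`
has coordinates `(e, h, f)`. -/
def sl2Coord : sl2 ≃ₗ[ℂ] (Fin 3 → ℂ) where
  toFun g := ![g.1 0 1, g.1 0 0, g.1 1 0]
  invFun v := ⟨!![v 1, v 0; v 2, -v 1], by rw [mem_sl2, Matrix.trace_fin_two_of]; ring⟩
  map_add' g h := by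
    ext i
    fin_cases i <;> simp
  map_smul' c g := by
    ext i
    fin_cases i <;> simp
  left_inv g := by
    have h : g.1 0 0 + g.1 1 1 = 0 := by
      have := (mem_sl2 g.1).1 g.2
      rwa [Matrix.trace_fin_two] at this
    apply Subtype.ext
    ext i j
    fin_cases i <;> fin_cases j <;> simp
    linear_combination -h
  right_inv v := by
    ext i
    fin_cases i <;> simp

/-- The basis `E, H, F` of `sl₂(ℂ)`. -/
def sl2Basis : Module.Basis (Fin 3) ℂ sl2 := Module.Basis.ofEquivFun sl2Coord

/-- The adjoint action as a three-dimensional matrix representation of `SL₂(ℂ)`. -/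
def AdMatrix : SL(2, ℂ) →* Matrix (Fin 3) (Fin 3) ℂ :=
  (LinearMap.toMatrixAlgEquiv sl2Basis : Module.End ℂ sl2 →* Matrix (Fin 3) (Fin 3) ℂ).comp Ad

/-! ## The genus one two-bridge knots `J(2m, 2n)` -/

/-- The word `w = (b a⁻¹)ᵐ (b⁻¹ a)ᵐ`, where `a`, `b` are the generators `0`, `1`. -/
def wordW (m : ℤ) : FreeGroup (Fin 2) :=
  (FreeGroup.of 1 * (FreeGroup.of 0)⁻¹) ^ m * ((FreeGroup.of 1)⁻¹ * FreeGroup.of 0) ^ m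

/-- The relator `wⁿ a (b wⁿ)⁻¹` of the knot group of `J(2m, 2n)`. -/
def relator (m n : ℤ) : Fin 1 → FreeGroup (Fin (1 + 1)) := fun _ =>
  wordW m ^ n * FreeGroup.of 0 * (FreeGroup.of 1 * wordW m ^ n)⁻¹

/-- The knot group `⟨a, b | wⁿ a = b wⁿ⟩` of `J(2m, 2n)`. -/
abbrev KnotGroup (m n : ℤ) : Type := PresGroup (relator m n)

/-- The meridian `a`. -/
def meridA (m n : ℤ) : KnotGroup m n := PresentedGroup.of 0

/-- The meridian `b`. -/
def meridB (m n : ℤ) : KnotGroup m n := PresentedGroup.of 1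

/-- The abelianization homomorphism of the knot group onto `ℤ = ⟨t⟩`; both meridians go to `t`. -/
def abel (m n : ℤ) : KnotGroup m n →* Multiplicative ℤ :=
  PresentedGroup.toGroup (f := fun _ => Multiplicative.ofAdd 1) (by
    rintro _ ⟨i, rfl⟩
    simp only [relator, map_mul, map_inv, FreeGroup.lift_apply_of]
    rw [mul_comm (Multiplicative.ofAdd (1 : ℤ)), mul_inv_cancel])

/-- The adjoint twisted Alexander polynomial of `J(2m, 2n)` associated to `ρ`, computed from the
presentation `⟨a, b | wⁿ a = b wⁿ⟩` by removing the column of the `j`-th generator. -/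
def adjointTAP (m n : ℤ) (ρ : KnotGroup m n →* SL(2, ℂ)) (j : Fin 2) : RatFunc ℂ :=
  wada (relator m n) (abel m n) (AdMatrix.comp ρ) j

/-- The Chebyshev polynomial `S_k` at `v`: `S₀ = 1`, `S₁ = v`, `S_k = v S_{k-1} - S_{k-2}`. -/
def chebS (k : ℤ) (v : ℂ) : ℂ := (Polynomial.Chebyshev.S ℂ k).eval v

def coeffA (m n : ℤ) (y : ℂ) : ℂ :=
  2 * n * ((2 * m + 2 * chebS m y * chebS (m - 1) y - y * chebS (m - 1) y ^ 2) / (y + 2))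

def coeffB (m n : ℤ) (y : ℂ) : ℂ :=
  -4 * (chebS m y + chebS (m - 1) y) ^ 2 *
      ((m * chebS m y + (m + 1) * chebS (m - 1) y) / ((y + 2) * chebS (m - 1) y))
    + 6 * m * chebS m y ^ 2
    + (4 + 4 * m - 4 * n - 2 * m * y) * chebS m y * chebS (m - 1) y
    + (2 + 2 * m - 4 * m * n - y + 2 * n * y + 2 * m * n * y) * chebS (m - 1) y ^ 2

def coeffC (m n : ℤ) (y : ℂ) : ℂ :=
  -(2 * m * n - 1) * (2 * chebS m y - y * chebS (m - 1) y) ^ 2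

end TwistedAlexander

end

open TwistedAlexander

open scoped MatrixGroups Topology

namespace TwistedAlexander

section Fox

variable {α : Type*} [DecidableEq α] {R : Type*} [Ring R] (Φ : MonoidAlgebra ℤ (FreeGroup α) →+* R)

theorem map_foxDeriv_mul (j : α) (u v : FreeGroup α) :
    Φ (foxDeriv j (u * v)) = Φ (foxDeriv j u) + Φ (MonoidAlgebra.of ℤ _ u) * Φ (foxDeriv j v) := by
  rw [foxDeriv_mul, map_add, map_mul]

theorem foxDeriv_one (j : α) : foxDeriv j (1 : FreeGroup α) = 0 := by
  have h := foxDeriv_mul j (1 : FreeGroup α) 1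
  rw [mul_one, map_one, one_mul] at h
  exact left_eq_add.1 h

theorem map_foxDeriv_inv (j : α) (u : FreeGroup α) :
    Φ (foxDeriv j u⁻¹) = -(Φ (MonoidAlgebra.of ℤ _ u⁻¹) * Φ (foxDeriv j u)) := by
  have h := map_foxDeriv_mul Φ j u⁻¹ u
  rw [inv_mul_cancel, foxDeriv_one, map_zero] at h
  exact eq_neg_of_add_eq_zero_left h.symm

omit [DecidableEq α] in
theorem map_of_inv_mul (u : FreeGroup α) :
    Φ (MonoidAlgebra.of ℤ _ u⁻¹) * Φ (MonoidAlgebra.of ℤ _ u) = 1 := by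
  rw [← map_mul, ← map_mul, inv_mul_cancel, map_one, map_one]

/-- The Fox derivative of a power, in terms of a function `G` playing the role of the geometric
sum `1 + u + ⋯ + u ^ (k - 1)`. -/
theorem map_foxDeriv_zpow (j : α) (u : FreeGroup α) (G : ℤ → R) (h0 : G 0 = 0)
    (hG : ∀ k, G (k + 1) = G k + Φ (MonoidAlgebra.of ℤ _ (u ^ k))) (k : ℤ) :
    Φ (foxDeriv j (u ^ k)) = G k * Φ (foxDeriv j u) := by
  have step : ∀ k : ℤ, Φ (foxDeriv j (u ^ (k + 1))) =
      Φ (foxDeriv j (u ^ k)) + Φ (MonoidAlgebra.of ℤ _ (u ^ k)) * Φ (foxDeriv j u) := fun k => by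
    rw [zpow_add_one, map_foxDeriv_mul]
  induction k using Int.induction_on with
  | zero => rw [zpow_zero, foxDeriv_one, map_zero, h0, zero_mul]
  | succ k ih => rw [step, hG, ih, add_mul]
  | pred k ih =>
    have h1 := step (-(k : ℤ) - 1)
    have h2 := hG (-(k : ℤ) - 1)
    rw [sub_add_cancel] at h1 h2
    rw [h1, h2, add_mul] at ih
    exact add_right_cancel ih

/-- The fundamental formula of the Fox calculus, for two generators. -/
theorem map_foxDeriv_fundamental (Φ : MonoidAlgebra ℤ (FreeGroup (Fin 2)) →+* R)
    (u : FreeGroup (Fin 2)) :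
    Φ (foxDeriv 0 u) * (Φ (MonoidAlgebra.of ℤ _ (FreeGroup.of 0)) - 1) +
      Φ (foxDeriv 1 u) * (Φ (MonoidAlgebra.of ℤ _ (FreeGroup.of 1)) - 1) =
      Φ (MonoidAlgebra.of ℤ _ u) - 1 := by
  have inv_case : ∀ u : FreeGroup (Fin 2),
      Φ (foxDeriv 0 u) * (Φ (MonoidAlgebra.of ℤ _ (FreeGroup.of 0)) - 1) +
        Φ (foxDeriv 1 u) * (Φ (MonoidAlgebra.of ℤ _ (FreeGroup.of 1)) - 1) =
        Φ (MonoidAlgebra.of ℤ _ u) - 1 →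
      Φ (foxDeriv 0 u⁻¹) * (Φ (MonoidAlgebra.of ℤ _ (FreeGroup.of 0)) - 1) +
        Φ (foxDeriv 1 u⁻¹) * (Φ (MonoidAlgebra.of ℤ _ (FreeGroup.of 1)) - 1) =
        Φ (MonoidAlgebra.of ℤ _ u⁻¹) - 1 := fun u h => by
    rw [map_foxDeriv_inv, map_foxDeriv_inv, neg_mul, neg_mul, mul_assoc, mul_assoc, ← neg_add,
      ← mul_add, h, mul_sub, map_of_inv_mul, mul_one, neg_sub]
  induction u using FreeGroup.induction_on with
  | C1 =>
    rw [foxDeriv_one, foxDeriv_one, map_zero, map_one, map_one, zero_mul, zero_mul, add_zero,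
      sub_self]
  | of i => fin_cases i <;> simp [foxDeriv_of]
  | inv_of i ih => exact inv_case _ ih
  | mul u v hu hv =>
    rw [map_foxDeriv_mul, map_foxDeriv_mul, map_mul, map_mul, ← sub_eq_zero]
    rw [← sub_eq_zero] at hu hv
    linear_combination (norm := noncomm_ring) hu + Φ (MonoidAlgebra.of ℤ _ u) * hv

end Fox

section Wada

variable {κ : Type*} [Fintype κ] [DecidableEq κ]

theorem Phi_of {l : ℕ} (r : Fin l → FreeGroup (Fin (l + 1)))
    (f : PresGroup r →* Multiplicative ℤ) (τ : PresGroup r →* Matrix κ κ ℂ)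
    (u : FreeGroup (Fin (l + 1))) :
    Phi r f τ (MonoidAlgebra.of ℤ _ u) = twist f τ (PresentedGroup.mk (Set.range r) u) := by
  rw [Phi, MonoidAlgebra.lift_of]
  rfl

/-- For one relator the quotient only involves matrices of the size of the representation. -/
theorem wada_eq (r : Fin 1 → FreeGroup (Fin (1 + 1)))
    (f : PresGroup r →* Multiplicative ℤ) (τ : PresGroup r →* Matrix κ κ ℂ) (j : Fin 2) :
    wada r f τ j = (Phi r f τ (foxDeriv (j.succAbove 0) (r 0))).det /
      (1 - Phi r f τ (MonoidAlgebra.of ℤ _ (FreeGroup.of j))).det := by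
  have h : foxMatrix r f τ j = (Phi r f τ (foxDeriv (j.succAbove 0) (r 0))).submatrix
      (Equiv.uniqueProd κ (Fin 1)) (Equiv.uniqueProd κ (Fin 1)) := by
    ext ⟨i, p⟩ ⟨k, q⟩
    obtain rfl := Subsingleton.elim i 0
    obtain rfl := Subsingleton.elim k 0
    rw [foxMatrix, Matrix.of_apply, Matrix.submatrix_apply]
    simp only [Equiv.uniqueProd_apply]
  rw [wada, h, Matrix.det_submatrix_equiv_self, map_sub, map_one]

/-- Conjugate representations have the same twisted Alexander invariant. -/
theorem wada_conj (r : Fin 1 → FreeGroup (Fin (1 + 1)))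
    (f : PresGroup r →* Multiplicative ℤ) (τ τ' : PresGroup r →* Matrix κ κ ℂ)
    (P Q : Matrix κ κ ℂ) (hQP : Q * P = 1) (h : ∀ g, τ' g = P * τ g * Q) (j : Fin 2) :
    wada r f τ' j = wada r f τ j := by
  have hPQ : P * Q = 1 := mul_eq_one_comm.1 hQP
  let c : Matrix κ κ ℂ →+* Matrix κ κ (RatFunc ℂ) := RatFunc.C.mapMatrix
  have hc' : c P * c Q = 1 := by rw [← map_mul, hPQ, map_one]
  have hd : (c P).det * (c Q).det = 1 := by rw [← Matrix.det_mul, hc', Matrix.det_one]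
  have key : ∀ v, Phi r f τ' v = c P * Phi r f τ v * c Q := by
    intro v
    induction v using MonoidAlgebra.induction_on with
    | of g =>
      rw [Phi_of, Phi_of]
      change (RatFunc.X ^ _ : RatFunc ℂ) • c (τ' _) =
        c P * ((RatFunc.X ^ _ : RatFunc ℂ) • c (τ _)) * c Q
      rw [h, map_mul, map_mul, mul_smul_comm, smul_mul_assoc]
    | add v w hv hw => rw [map_add, map_add, hv, hw, mul_add, add_mul]
    | smul n v hv =>
      rw [Algebra.smul_def, eq_intCast, map_mul, map_mul, map_intCast, map_intCast, hv,
        ← mul_assoc, ← mul_assoc, ← mul_assoc, Int.cast_comm]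
  have hdet : ∀ X, (c P * X * c Q).det = X.det := fun X => by
    rw [Matrix.det_mul, Matrix.det_mul]
    linear_combination X.det * hd
  rw [wada_eq, wada_eq, key (foxDeriv _ _), hdet]
  congr 1
  rw [key, ← hdet (1 - Phi r f τ _), mul_sub, sub_mul, mul_one, hc']

end Wada

/-! ### Chebyshev polynomials and powers in `SL₂(ℂ)` -/

theorem chebS_add_one (k : ℤ) (v : ℂ) : chebS (k + 1) v = v * chebS k v - chebS (k - 1) v := by
  simp [chebS, Polynomial.Chebyshev.S_add_one]

theorem chebS_sub_two (k : ℤ) (v : ℂ) : chebS (k - 2) v = v * chebS (k - 1) v - chebS k v := by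
  simp [chebS, Polynomial.Chebyshev.S_sub_two]

theorem chebS_neg_one (v : ℂ) : chebS (-1) v = 0 := by simp [chebS]

theorem chebS_neg_two (v : ℂ) : chebS (-2) v = -1 := by simp [chebS]

theorem chebS_sq_add_sq (k : ℤ) (v : ℂ) :
    chebS (k - 1) v ^ 2 + chebS (k - 2) v ^ 2 - v * chebS (k - 1) v * chebS (k - 2) v = 1 := by
  induction k using Int.induction_on with
  | zero => simp [chebS_neg_one, chebS_neg_two]
  | succ k ih =>
    rw [chebS_sub_two] at ih ⊢
    rw [show (k : ℤ) + 1 - 1 = k by ring, chebS_add_one]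
    linear_combination ih
  | pred k ih =>
    have h := chebS_sub_two (-(k : ℤ) - 1) v
    rw [show -(k : ℤ) - 1 - 1 = -k - 2 by ring] at *
    rw [h]
    linear_combination ih

theorem chebS_two (k : ℤ) : chebS k 2 = k + 1 := by
  simp [chebS]

theorem SL2_sq (g : SL(2, ℂ)) : g.1 * g.1 = g.1.trace • g.1 - 1 := by
  have h := g.2
  rw [Matrix.det_fin_two] at h
  ext i j
  fin_cases i <;> fin_cases j <;>
    simp [Matrix.mul_apply, Fin.sum_univ_two, Matrix.trace_fin_two] <;>
    first | linear_combination -h | ring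

theorem SL2_inv (g : SL(2, ℂ)) : (g⁻¹).1 = g.1.trace • (1 : Matrix (Fin 2) (Fin 2) ℂ) - g.1 := by
  rw [Matrix.SpecialLinearGroup.coe_inv, Matrix.adjugate_fin_two]
  ext i j
  fin_cases i <;> fin_cases j <;> simp [Matrix.trace_fin_two]

theorem SL2_zpow (g : SL(2, ℂ)) (k : ℤ) :
    (g ^ k).1 = chebS (k - 1) g.1.trace • g.1 - chebS (k - 2) g.1.trace • 1 := by
  induction k using Int.induction_on with
  | zero => simp [chebS_neg_one, chebS_neg_two]
  | succ k ih =>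
    rw [zpow_add_one, Matrix.SpecialLinearGroup.coe_mul, ih, sub_mul, smul_mul_assoc, SL2_sq,
      show (k : ℤ) + 1 - 2 = k - 1 by ring, show (k : ℤ) + 1 - 1 = k by ring,
      smul_mul_assoc, one_mul, chebS_sub_two]
    module
  | pred k ih =>
    rw [zpow_sub_one, Matrix.SpecialLinearGroup.coe_mul, ih, SL2_inv,
      show -(k : ℤ) - 1 - 2 = (-k - 1) - 2 by ring,
      chebS_sub_two (-(k : ℤ) - 1), show -(k : ℤ) - 1 - 1 = -k - 2 by ring]
    simp only [sub_mul, mul_sub, smul_mul_assoc, mul_smul_comm, mul_one, one_mul, SL2_sq]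
    module

/-! ### The adjoint action in coordinates -/

/-- The matrix of `g ↦ X g - g X` on `sl₂(ℂ)`. -/
def adMat (X : Matrix (Fin 2) (Fin 2) ℂ) : Matrix (Fin 3) (Fin 3) ℂ :=
  !![X 0 0 - X 1 1, -2 * X 0 1, 0; -X 1 0, 0, X 0 1; 0, 2 * X 1 0, X 1 1 - X 0 0]

theorem AdMatrix_apply (g : SL(2, ℂ)) (i j : Fin 3) :
    AdMatrix g i j = sl2Coord (Ad g (sl2Coord.symm (Pi.single j 1))) i := by
  change LinearMap.toMatrix sl2Basis sl2Basis (Ad g) i j = _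
  rw [LinearMap.toMatrix_apply]
  simp [sl2Basis]

theorem AdMatrix_eq_of (g : SL(2, ℂ)) : AdMatrix g =
    !![g.1 0 0 ^ 2, -2 * g.1 0 0 * g.1 0 1, -g.1 0 1 ^ 2;
      -g.1 0 0 * g.1 1 0, g.1 0 0 * g.1 1 1 + g.1 0 1 * g.1 1 0, g.1 0 1 * g.1 1 1;
      -g.1 1 0 ^ 2, 2 * g.1 1 0 * g.1 1 1, g.1 1 1 ^ 2] := by
  ext i j
  rw [AdMatrix_apply]
  fin_cases i <;> fin_cases j <;>
    simp [sl2Coord, Ad, Matrix.adjugate_fin_two, Matrix.mul_apply, Fin.sum_univ_two] <;> ring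

theorem AdMatrix_eq (g : SL(2, ℂ)) :
    AdMatrix g = 1 + (g.1.trace / 2) • adMat g.1 + (1 / 2 : ℂ) • (adMat g.1 * adMat g.1) := by
  have h := g.2
  rw [Matrix.det_fin_two] at h
  rw [AdMatrix_eq_of]
  ext i j
  fin_cases i <;> fin_cases j <;>
    simp [adMat, Matrix.trace_fin_two] <;>
    first | linear_combination h | ring

theorem adMat_cube (X : Matrix (Fin 2) (Fin 2) ℂ) :
    adMat X * (adMat X * adMat X) = (X.trace ^ 2 - 4 * X.det) • adMat X := by
  ext i j
  fin_cases i <;> fin_cases j <;>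
    simp [adMat, Matrix.mul_apply, Fin.sum_univ_three, Matrix.trace_fin_two,
      Matrix.det_fin_two] <;> ring

theorem adMat_smul_sub_smul_one (X : Matrix (Fin 2) (Fin 2) ℂ) (c d : ℂ) :
    adMat (c • X - d • 1) = c • adMat X := by
  ext i j
  fin_cases i <;> fin_cases j <;> simp [adMat] <;> ring

/-- The quadratic polynomial `c + d N + e N²` in a matrix `N`. -/
def quad (N : Matrix (Fin 3) (Fin 3) ℂ) (c d e : ℂ) : Matrix (Fin 3) (Fin 3) ℂ :=
  c • 1 + d • N + e • (N * N)

theorem quad_mul_quad {N : Matrix (Fin 3) (Fin 3) ℂ} {δ : ℂ} (h : N * (N * N) = δ • N)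
    (c d e c' d' e' : ℂ) : quad N c d e * quad N c' d' e' =
      quad N (c * c') (c * d' + d * c' + δ * (d * e' + e * d'))
        (c * e' + e * c' + d * d' + δ * (e * e')) := by
  simp only [quad, add_mul, mul_add, smul_mul_assoc, mul_smul_comm, mul_one, one_mul, mul_assoc,
    h]
  module

theorem quad_commute (N : Matrix (Fin 3) (Fin 3) ℂ) (c d e c' d' e' : ℂ) :
    Commute (quad N c d e) (quad N c' d' e') := by
  unfold Commute SemiconjBy quad
  simp only [add_mul, mul_add, smul_mul_assoc, mul_smul_comm, mul_one, one_mul, mul_assoc]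
  module

theorem smul_one_eq_quad (N : Matrix (Fin 3) (Fin 3) ℂ) (c : ℂ) :
    c • (1 : Matrix (Fin 3) (Fin 3) ℂ) = quad N c 0 0 := by
  simp [quad]

theorem AdMatrix_eq_quad (g : SL(2, ℂ)) :
    AdMatrix g = quad (adMat g.1) 1 (g.1.trace / 2) (1 / 2) := by
  rw [AdMatrix_eq, quad, one_smul]

theorem adMat_SL2_cube (g : SL(2, ℂ)) :
    adMat g.1 * (adMat g.1 * adMat g.1) = (g.1.trace ^ 2 - 4) • adMat g.1 := by
  rw [adMat_cube, g.2, mul_one]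

theorem AdMatrix_zpow_eq_quad (g : SL(2, ℂ)) (k : ℤ) :
    AdMatrix (g ^ k) = quad (adMat g.1) 1
      ((g.1.trace * chebS (k - 1) g.1.trace - 2 * chebS (k - 2) g.1.trace) *
        chebS (k - 1) g.1.trace / 2) (chebS (k - 1) g.1.trace ^ 2 / 2) := by
  have h : (g ^ k).1.trace =
      g.1.trace * chebS (k - 1) g.1.trace - 2 * chebS (k - 2) g.1.trace := by
    rw [SL2_zpow, Matrix.trace_sub, Matrix.trace_smul, Matrix.trace_smul, Matrix.trace_one]
    simp
    ring
  rw [AdMatrix_eq_quad, h, SL2_zpow, adMat_smul_sub_smul_one]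
  simp only [quad, smul_mul_assoc, mul_smul_comm, smul_smul]
  module

theorem det_quad_adMat (X : Matrix (Fin 2) (Fin 2) ℂ) (c d e : ℂ) :
    (quad (adMat X) c d e).det =
      c * ((c + e * (X.trace ^ 2 - 4 * X.det)) ^ 2 - d ^ 2 * (X.trace ^ 2 - 4 * X.det)) := by
  simp [quad, adMat, Matrix.det_fin_three,
    Matrix.trace_fin_two, Matrix.det_fin_two]
  ring

/-! ### Geometric sums of powers in the adjoint representation -/

/-- `G k` is the geometric sum `1 + Ad g + ⋯ + (Ad g) ^ (k - 1)`, continued to negative `k`. -/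
structure IsGeomSum (g : SL(2, ℂ)) (G : ℤ → Matrix (Fin 3) (Fin 3) ℂ) : Prop where
  zero : G 0 = 0
  add_one (k : ℤ) : G (k + 1) = G k + AdMatrix (g ^ k)

/-- The geometric sum, for `g` with distinct eigenvalues. -/
noncomputable def geomAd (g : SL(2, ℂ)) (k : ℤ) : Matrix (Fin 3) (Fin 3) ℂ :=
  quad (adMat g.1) k (chebS (k - 1) g.1.trace * chebS (k - 2) g.1.trace / 2)
    ((chebS (k - 1) g.1.trace * (2 * chebS (k - 1) g.1.trace - g.1.trace * chebS (k - 2) g.1.trace)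
      - 2 * k) / (2 * (g.1.trace ^ 2 - 4)))

/-- A multiple of the inverse of the geometric sum. -/
noncomputable def geomAdInv (g : SL(2, ℂ)) (k : ℤ) (σ : ℂ) : Matrix (Fin 3) (Fin 3) ℂ :=
  quad (adMat g.1) 1 (-(k * σ / 2))
    ((k * (1 - σ * g.1.trace / 2) - 1) / (g.1.trace ^ 2 - 4))

theorem isGeomSum_geomAd (g : SL(2, ℂ)) (hg : g.1.trace ^ 2 - 4 ≠ 0) : IsGeomSum g (geomAd g) where
  zero := by simp [geomAd, quad, chebS_neg_one]
  add_one k := by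
    rw [AdMatrix_zpow_eq_quad, geomAd, geomAd]
    have h := chebS_sq_add_sq k g.1.trace
    have h1 := chebS_add_one (k - 1) g.1.trace
    rw [show k - 1 + 1 = k by ring, show k - 1 - 1 = k - 2 by ring] at h1
    rw [show k + 1 - 1 = k by ring, show k + 1 - 2 = k - 1 by ring, h1]
    generalize chebS (k - 1) g.1.trace = S at *
    generalize chebS (k - 2) g.1.trace = S' at *
    generalize g.1.trace = y at *
    simp only [quad, Int.cast_add, Int.cast_one]
    match_scalars
    · ring
    · ring
    · field_simp
      linear_combination 2 * h

theorem geomAd_mul_geomAdInv (g : SL(2, ℂ)) (hg : g.1.trace ^ 2 - 4 ≠ 0) (k : ℤ) (σ : ℂ)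
    (hσ : chebS (k - 2) g.1.trace = σ * chebS (k - 1) g.1.trace) :
    geomAd g k * geomAdInv g k σ = (k : ℂ) • 1 := by
  rw [geomAd, geomAdInv, quad_mul_quad (adMat_SL2_cube g), smul_one_eq_quad (adMat g.1)]
  have h := chebS_sq_add_sq k g.1.trace
  rw [hσ] at *
  generalize chebS (k - 1) g.1.trace = S at *
  generalize g.1.trace = y at *
  congr 1
  · ring
  · field_simp
    ring
  · field_simp
    linear_combination 4 * k * h

theorem det_geomAd (g : SL(2, ℂ)) (hg : g.1.trace ^ 2 - 4 ≠ 0) (k : ℤ) :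
    (geomAd g k).det = k * chebS (k - 1) g.1.trace ^ 2 := by
  rw [geomAd, det_quad_adMat, g.2, mul_one]
  have h := chebS_sq_add_sq k g.1.trace
  generalize chebS (k - 1) g.1.trace = S at *
  generalize chebS (k - 2) g.1.trace = S' at *
  generalize g.1.trace = y at *
  field_simp
  linear_combination 4 * k * S ^ 2 * h

/-- The geometric sum, for `g` with trace `2`. -/
theorem exists_isGeomSum_of_trace_eq_two (g : SL(2, ℂ)) (hg : g.1.trace = 2) :
    IsGeomSum g fun k => quad (adMat g.1) k (k * (k - 1) / 2) (k * (k - 1) * (2 * k - 1) / 12) where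
  zero := by simp [quad]
  add_one k := by
    rw [AdMatrix_zpow_eq_quad, hg, chebS_two, chebS_two]
    simp only [quad, Int.cast_add, Int.cast_one, Int.cast_sub, Int.cast_ofNat]
    match_scalars <;> ring

theorem IsGeomSum.mul_sub_one {g : SL(2, ℂ)} {G : ℤ → Matrix (Fin 3) (Fin 3) ℂ}
    (hG : IsGeomSum g G) (k : ℤ) : G k * (AdMatrix g - 1) = AdMatrix (g ^ k) - 1 := by
  have step : ∀ k : ℤ, G (k + 1) * (AdMatrix g - 1) =
      G k * (AdMatrix g - 1) + (AdMatrix (g ^ (k + 1)) - AdMatrix (g ^ k)) := fun k => by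
    rw [hG.add_one, add_mul, mul_sub (AdMatrix _), ← map_mul, ← zpow_add_one, mul_one]
  induction k using Int.induction_on with
  | zero => simp [hG.zero]
  | succ k ih => rw [step, ih]; abel
  | pred k ih =>
    have h := step (-(k : ℤ) - 1)
    rw [sub_add_cancel, ih] at h
    rw [← sub_eq_zero] at h ⊢
    linear_combination (norm := abel) -h

theorem geomAd_commute (g : SL(2, ℂ)) (k j : ℤ) :
    AdMatrix (g ^ j) * geomAd g k = geomAd g k * AdMatrix (g ^ j) := by
  rw [AdMatrix_zpow_eq_quad, geomAd]
  exact quad_commute _ _ _ _ _ _ _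

/-! ### The Fox matrix of the knot group -/

theorem wordW_eq (m : ℤ) : wordW m =
    (FreeGroup.of 1 * (FreeGroup.of 0)⁻¹) ^ m * ((FreeGroup.of 0)⁻¹ *
      (FreeGroup.of 1 * (FreeGroup.of 0)⁻¹) ^ (-m) * FreeGroup.of 0) := by
  have h : (FreeGroup.of 1)⁻¹ * FreeGroup.of (0 : Fin 2) = (FreeGroup.of 0)⁻¹ *
      (FreeGroup.of 1 * (FreeGroup.of 0)⁻¹)⁻¹ * (FreeGroup.of 0)⁻¹⁻¹ := by group
  rw [wordW, h, conj_zpow, inv_zpow', inv_inv]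

/-- The value of the word `w` at a pair of elements of a group. -/
def wordEval {G : Type*} [Group G] (a b : G) (m : ℤ) : G :=
  (b * a⁻¹) ^ m * (a⁻¹ * (b * a⁻¹) ^ (-m) * a)

section

variable {m n : ℤ} (ρ : KnotGroup m n →* SL(2, ℂ))

theorem map_mk_wordW : ρ (PresentedGroup.mk _ (wordW m)) =
    wordEval (ρ (meridA m n)) (ρ (meridB m n)) m := by
  simp only [wordW_eq, map_mul, map_zpow, map_inv]
  rfl

theorem mk_relator : PresentedGroup.mk (Set.range (relator m n)) (relator m n 0) = 1 :=
  PresentedGroup.one_of_mem ⟨0, rfl⟩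

theorem rho_relation :
    wordEval (ρ (meridA m n)) (ρ (meridB m n)) m ^ n * ρ (meridA m n) =
      ρ (meridB m n) * wordEval (ρ (meridA m n)) (ρ (meridB m n)) m ^ n := by
  have h := congrArg ρ (mk_relator (m := m) (n := n))
  rw [relator, map_mul, map_inv, map_mul, map_inv, map_one, mul_inv_eq_one, map_mul, map_mul,
    map_mul, map_mul, map_zpow, map_zpow, map_mk_wordW] at h
  exact h

/-- Constant matrices over the field of rational functions. -/
noncomputable def constMat : Matrix (Fin 3) (Fin 3) ℂ →+* Matrix (Fin 3) (Fin 3) (RatFunc ℂ) :=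
  RatFunc.C.mapMatrix

theorem Phi_AdMatrix_of (u : FreeGroup (Fin 2)) :
    Phi (relator m n) (abel m n) (AdMatrix.comp ρ) (MonoidAlgebra.of ℤ _ u) =
      (RatFunc.X ^ (abel m n (PresentedGroup.mk _ u)).toAdd : RatFunc ℂ) •
        constMat (AdMatrix (ρ (PresentedGroup.mk _ u))) :=
  Phi_of _ _ _ _

theorem abel_of (i : Fin 2) :
    abel m n (PresentedGroup.mk _ (FreeGroup.of i)) = Multiplicative.ofAdd 1 :=
  PresentedGroup.toGroup.of _

theorem Phi_AdMatrix_meridian (i : Fin 2) :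
    Phi (relator m n) (abel m n) (AdMatrix.comp ρ) (MonoidAlgebra.of ℤ _ (FreeGroup.of i)) =
      (RatFunc.X : RatFunc ℂ) •
        constMat (AdMatrix (ρ (PresentedGroup.mk _ (FreeGroup.of i)))) := by
  rw [Phi_AdMatrix_of, abel_of, toAdd_ofAdd, zpow_one]

theorem Phi_AdMatrix_meridian_inv (i : Fin 2) :
    Phi (relator m n) (abel m n) (AdMatrix.comp ρ) (MonoidAlgebra.of ℤ _ (FreeGroup.of i)⁻¹) =
      (RatFunc.X⁻¹ : RatFunc ℂ) •
        constMat (AdMatrix (ρ (PresentedGroup.mk _ (FreeGroup.of i)))⁻¹) := by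
  rw [Phi_AdMatrix_of, map_inv, map_inv, abel_of, ← ofAdd_neg, toAdd_ofAdd, zpow_neg_one,
    map_inv]

theorem Phi_AdMatrix_of_abel_eq_one (u : FreeGroup (Fin 2))
    (hu : abel m n (PresentedGroup.mk _ u) = 1) :
    Phi (relator m n) (abel m n) (AdMatrix.comp ρ) (MonoidAlgebra.of ℤ _ u) =
      constMat (AdMatrix (ρ (PresentedGroup.mk _ u))) := by
  rw [Phi_AdMatrix_of, hu, toAdd_one, zpow_zero, one_smul]

end

/-- The coefficient of `t` in the Fox matrix. -/
noncomputable def foxCoeffOne (b : SL(2, ℂ)) (U W : Matrix (Fin 3) (Fin 3) ℂ) :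
    Matrix (Fin 3) (Fin 3) ℂ :=
  -(AdMatrix b * W * U)

/-- The constant coefficient in the Fox matrix. -/
noncomputable def foxCoeffZero (a b : SL(2, ℂ)) (m : ℤ) (U W : Matrix (Fin 3) (Fin 3) ℂ) :
    Matrix (Fin 3) (Fin 3) ℂ :=
  W * U + AdMatrix b * W * AdMatrix ((b * a⁻¹) ^ m * a⁻¹ * (b * a⁻¹) ^ (-m)) * U - 1

/-- The coefficient of `t⁻¹` in the Fox matrix. -/
noncomputable def foxCoeffNegOne (a b : SL(2, ℂ)) (m : ℤ) (U W : Matrix (Fin 3) (Fin 3) ℂ) :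
    Matrix (Fin 3) (Fin 3) ℂ :=
  -(W * AdMatrix ((b * a⁻¹) ^ m * a⁻¹ * (b * a⁻¹) ^ (-m)) * U)

variable {m n : ℤ} (ρ : KnotGroup m n →* SL(2, ℂ))

theorem Phi_foxDeriv_relator (U W : ℤ → Matrix (Fin 3) (Fin 3) ℂ)
    (hU : IsGeomSum (ρ (meridB m n) * (ρ (meridA m n))⁻¹) U)
    (hW : IsGeomSum (wordEval (ρ (meridA m n)) (ρ (meridB m n)) m) W) :
    Phi (relator m n) (abel m n) (AdMatrix.comp ρ) (foxDeriv 1 (relator m n 0)) =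
      (RatFunc.X : RatFunc ℂ) • constMat (foxCoeffOne (ρ (meridB m n)) (U m) (W n)) +
        constMat (foxCoeffZero (ρ (meridA m n)) (ρ (meridB m n)) m (U m) (W n)) +
        (RatFunc.X⁻¹ : RatFunc ℂ) •
          constMat (foxCoeffNegOne (ρ (meridA m n)) (ρ (meridB m n)) m (U m) (W n)) := by
  let Φ : MonoidAlgebra ℤ (FreeGroup (Fin 2)) →+* Matrix (Fin 3) (Fin 3) (RatFunc ℂ) :=
    (Phi (relator m n) (abel m n) (AdMatrix.comp ρ)).toRingHom
  have hΦ : ∀ v, Φ v = Phi (relator m n) (abel m n) (AdMatrix.comp ρ) v := fun _ => rfl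
  rw [← hΦ]
  have ha : ρ (PresentedGroup.mk (Set.range (relator m n)) (FreeGroup.of 0)) = ρ (meridA m n) := rfl
  have hb : ρ (PresentedGroup.mk (Set.range (relator m n)) (FreeGroup.of 1)) = ρ (meridB m n) := rfl
  have hu : ∀ k : ℤ, Φ (MonoidAlgebra.of ℤ _ ((FreeGroup.of 1 * (FreeGroup.of 0)⁻¹) ^ k)) =
      constMat (AdMatrix ((ρ (meridB m n) * (ρ (meridA m n))⁻¹) ^ k)) := fun k => by
    rw [hΦ, Phi_AdMatrix_of_abel_eq_one]
    · simp only [map_zpow, map_mul, map_inv, ha, hb]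
    · simp only [map_zpow, map_mul, map_inv, abel_of, mul_inv_cancel, one_zpow]
  have hw : ∀ k : ℤ, Φ (MonoidAlgebra.of ℤ _ (wordW m ^ k)) =
      constMat (AdMatrix (wordEval (ρ (meridA m n)) (ρ (meridB m n)) m ^ k)) := fun k => by
    rw [hΦ, Phi_AdMatrix_of_abel_eq_one]
    · rw [map_zpow, map_zpow, map_mk_wordW]
    · simp only [map_zpow, map_mul, map_inv, abel_of, mul_inv_cancel, one_zpow, wordW_eq, mul_one,
        inv_mul_cancel]
  have hDa : foxDeriv (1 : Fin 2) (FreeGroup.of 0) = 0 := by simp [foxDeriv_of]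
  have hDb : foxDeriv (1 : Fin 2) (FreeGroup.of 1) = 1 := by simp [foxDeriv_of]
  have hDu : Φ (foxDeriv 1 (FreeGroup.of 1 * (FreeGroup.of 0)⁻¹)) = 1 := by
    rw [map_foxDeriv_mul, map_foxDeriv_inv, hDa, hDb, map_one, map_zero, mul_zero, neg_zero,
      mul_zero, add_zero]
  have hDum : Φ (foxDeriv 1 ((FreeGroup.of 1 * (FreeGroup.of 0)⁻¹) ^ m)) = constMat (U m) := by
    rw [map_foxDeriv_zpow Φ 1 _ (fun k => constMat (U k)) (by rw [hU.zero, map_zero])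
      (fun k => by rw [hU.add_one, map_add, hu]), hDu, mul_one]
  have hDw : Φ (foxDeriv 1 (wordW m)) = constMat (U m) - (RatFunc.X⁻¹ : RatFunc ℂ) • constMat
      (AdMatrix ((ρ (meridB m n) * (ρ (meridA m n))⁻¹) ^ m * (ρ (meridA m n))⁻¹ *
        (ρ (meridB m n) * (ρ (meridA m n))⁻¹) ^ (-m)) * U m) := by
    rw [wordW_eq, map_foxDeriv_mul, map_foxDeriv_mul, map_foxDeriv_mul, hDa, map_zero, mul_zero,
      add_zero, map_foxDeriv_inv, hDa, map_zero, mul_zero, neg_zero, zero_add, zpow_neg,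
      map_foxDeriv_inv, ← zpow_neg, hu, hu, hDum, hΦ, Phi_AdMatrix_meridian_inv, ha]
    simp only [map_mul, smul_mul_assoc, mul_smul_comm, mul_neg, mul_assoc, sub_eq_add_neg]
  have hDwn : Φ (foxDeriv 1 (wordW m ^ n)) = constMat (W n) * Φ (foxDeriv 1 (wordW m)) :=
    map_foxDeriv_zpow Φ 1 _ (fun k => constMat (W k)) (by rw [hW.zero, map_zero])
      (fun k => by rw [hW.add_one, map_add, hw]) n
  have hr : Φ (MonoidAlgebra.of ℤ _ (relator m n 0)) = 1 := by
    rw [hΦ, Phi_of, mk_relator, map_one]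
  have hD : Φ (foxDeriv 1 (relator m n 0)) = Φ (foxDeriv 1 (wordW m ^ n * FreeGroup.of 0)) -
      Φ (foxDeriv 1 (FreeGroup.of 1 * wordW m ^ n)) := by
    have h : relator m n 0 * (FreeGroup.of 1 * wordW m ^ n) = wordW m ^ n * FreeGroup.of 0 := by
      rw [relator, inv_mul_cancel_right]
    rw [← h, map_foxDeriv_mul Φ 1 (relator m n 0), hr, one_mul, add_sub_cancel_right]
  have hX : (RatFunc.X : RatFunc ℂ)⁻¹ * RatFunc.X = 1 := inv_mul_cancel₀ RatFunc.X_ne_zero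
  rw [hD, map_foxDeriv_mul, map_foxDeriv_mul, hDa, hDb, map_zero, map_one, mul_zero, add_zero,
    hDwn, hDw, hΦ, Phi_AdMatrix_meridian, hb, foxCoeffOne, foxCoeffZero, foxCoeffNegOne]
  simp only [map_mul, map_sub, map_add, map_neg, map_one, smul_mul_assoc, mul_smul_comm, mul_assoc,
    mul_sub, smul_neg, smul_smul, hX, one_smul]
  abel

theorem det_one_sub_smul_AdMatrix (g : SL(2, ℂ)) :
    (1 - (RatFunc.X : RatFunc ℂ) • constMat (AdMatrix g)).det =
      (1 - RatFunc.X) * (1 - RatFunc.C (g.1.trace ^ 2 - 2) * RatFunc.X + RatFunc.X ^ 2) := by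
  have h : RatFunc.C (g.1 0 0) * RatFunc.C (g.1 1 1) - RatFunc.C (g.1 0 1) * RatFunc.C (g.1 1 0)
      = 1 := by
    rw [← map_mul, ← map_mul, ← map_sub, ← Matrix.det_fin_two, g.2, map_one]
  rw [AdMatrix_eq_of, Matrix.trace_fin_two]
  simp only [constMat, RingHom.mapMatrix_apply, Matrix.det_fin_three, Matrix.sub_apply,
    Matrix.smul_apply, Matrix.map_apply, Matrix.of_apply, Matrix.one_apply, smul_eq_mul]
  simp only [Matrix.cons_val, map_mul, map_add, map_neg, map_pow, map_sub, Fin.reduceEq,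
    if_true, if_false, map_ofNat]
  generalize RatFunc.C (g.1 0 0) = p at *
  generalize RatFunc.C (g.1 1 1) = q at *
  generalize RatFunc.C (g.1 0 1) = r at *
  generalize RatFunc.C (g.1 1 0) = s at *
  generalize (RatFunc.X : RatFunc ℂ) = t
  trans (1 - t * (p * q - r * s)) *
    (1 - t * ((p + q) ^ 2 - 2 * (p * q - r * s)) + t ^ 2 * (p * q - r * s) ^ 2)
  · ring
  · rw [h]
    ring

theorem det_one_sub_smul_ne_zero (c : ℂ) :
    (1 - RatFunc.X : RatFunc ℂ) * (1 - RatFunc.C c * RatFunc.X + RatFunc.X ^ 2) ≠ 0 := by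
  have h : (1 - RatFunc.X : RatFunc ℂ) * (1 - RatFunc.C c * RatFunc.X + RatFunc.X ^ 2) =
      algebraMap (Polynomial ℂ) (RatFunc ℂ) ((1 - Polynomial.X) *
        (1 - Polynomial.C c * Polynomial.X + Polynomial.X ^ 2)) := by
    simp
  rw [h]
  refine RatFunc.algebraMap_ne_zero fun h0 => ?_
  have h1 := congrArg (Polynomial.eval 0) h0
  simp at h1

theorem trace_meridB : (ρ (meridB m n)).1.trace = (ρ (meridA m n)).1.trace := by
  have h := rho_relation ρ
  rw [← mul_inv_eq_iff_eq_mul] at h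
  rw [← h, Matrix.SpecialLinearGroup.coe_mul, Matrix.trace_mul_comm,
    ← Matrix.SpecialLinearGroup.coe_mul, inv_mul_cancel_left]

/-- The invariant as a determinant, with the columns of either generator removed. -/
theorem adjointTAP_eq (U W : ℤ → Matrix (Fin 3) (Fin 3) ℂ)
    (hU : IsGeomSum (ρ (meridB m n) * (ρ (meridA m n))⁻¹) U)
    (hW : IsGeomSum (wordEval (ρ (meridA m n)) (ρ (meridB m n)) m) W) (j : Fin 2) :
    adjointTAP m n ρ j = (-1) ^ (j : ℕ) *
      (((RatFunc.X : RatFunc ℂ) • constMat (foxCoeffOne (ρ (meridB m n)) (U m) (W n)) +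
        constMat (foxCoeffZero (ρ (meridA m n)) (ρ (meridB m n)) m (U m) (W n)) +
        (RatFunc.X⁻¹ : RatFunc ℂ) •
          constMat (foxCoeffNegOne (ρ (meridA m n)) (ρ (meridB m n)) m (U m) (W n))).det /
      ((1 - RatFunc.X) *
        (1 - RatFunc.C ((ρ (meridA m n)).1.trace ^ 2 - 2) * RatFunc.X + RatFunc.X ^ 2))) := by
  have ha := det_one_sub_smul_AdMatrix (ρ (meridA m n))
  have hb := det_one_sub_smul_AdMatrix (ρ (meridB m n))
  rw [trace_meridB] at hb
  have hne := det_one_sub_smul_ne_zero ((ρ (meridA m n)).1.trace ^ 2 - 2)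
  have hf := map_foxDeriv_fundamental (Phi (relator m n) (abel m n) (AdMatrix.comp ρ)).toRingHom
    (relator m n 0)
  have hr : Phi (relator m n) (abel m n) (AdMatrix.comp ρ)
      (MonoidAlgebra.of ℤ _ (relator m n 0)) = 1 := by
    rw [Phi_of, mk_relator, map_one]
  change Phi _ _ _ _ * (Phi _ _ _ _ - 1) + Phi _ _ _ _ * (Phi _ _ _ _ - 1) = Phi _ _ _ _ - 1 at hf
  rw [hr, sub_self, Phi_AdMatrix_meridian, Phi_AdMatrix_meridian,
    Phi_foxDeriv_relator ρ U W hU hW] at hf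
  rw [adjointTAP, wada_eq, Phi_AdMatrix_meridian]
  fin_cases j
  · change Matrix.det (Phi _ _ _ (foxDeriv 1 _)) /
      (1 - _ • constMat (AdMatrix (ρ (meridA m n)))).det = _
    rw [Phi_foxDeriv_relator ρ U W hU hW, ha]
    simp
  · change Matrix.det (Phi _ _ _ (foxDeriv 0 _)) /
      (1 - _ • constMat (AdMatrix (ρ (meridB m n)))).det = _
    change _ * (_ • constMat (AdMatrix (ρ (meridA m n))) - 1) +
      _ * (_ • constMat (AdMatrix (ρ (meridB m n))) - 1) = _ at hf
    have hf' := congrArg Matrix.det (eq_neg_of_add_eq_zero_left hf)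
    rw [Matrix.det_mul, Matrix.det_neg, Matrix.det_mul, ← neg_sub 1, ← neg_sub 1, Matrix.det_neg,
      Matrix.det_neg, ha, hb, Fintype.card_fin] at hf'
    rw [hb, Fin.mk_one, Fin.val_one, pow_one, neg_one_mul, ← neg_div]
    congr 1
    apply mul_right_cancel₀ hne
    linear_combination -hf'

/-! ### Symmetries of the Fox matrix -/

theorem IsGeomSum.unique {g : SL(2, ℂ)} {G G' : ℤ → Matrix (Fin 3) (Fin 3) ℂ}
    (hG : IsGeomSum g G) (hG' : IsGeomSum g G') (k : ℤ) : G k = G' k := by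
  induction k using Int.induction_on with
  | zero => rw [hG.zero, hG'.zero]
  | succ k ih => rw [hG.add_one, hG'.add_one, ih]
  | pred k ih =>
    have h := hG.add_one (-(k : ℤ) - 1)
    have h' := hG'.add_one (-(k : ℤ) - 1)
    rw [sub_add_cancel] at h h'
    rw [h, h'] at ih
    exact add_right_cancel ih

theorem AdMatrix_mul_inv (g : SL(2, ℂ)) : AdMatrix g * AdMatrix g⁻¹ = 1 := by
  rw [← map_mul, mul_inv_cancel, map_one]

theorem AdMatrix_inv_mul (g : SL(2, ℂ)) : AdMatrix g⁻¹ * AdMatrix g = 1 := by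
  rw [← map_mul, inv_mul_cancel, map_one]

theorem IsGeomSum.conj {g : SL(2, ℂ)} {G : ℤ → Matrix (Fin 3) (Fin 3) ℂ} (hG : IsGeomSum g G)
    (c : SL(2, ℂ)) :
    IsGeomSum (c * g * c⁻¹) fun k => AdMatrix c * G k * AdMatrix c⁻¹ where
  zero := by simp [hG.zero]
  add_one k := by
    rw [hG.add_one, mul_add, add_mul, conj_zpow, map_mul, map_mul]

theorem IsGeomSum.inv {g : SL(2, ℂ)} {G : ℤ → Matrix (Fin 3) (Fin 3) ℂ} (hG : IsGeomSum g G) :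
    IsGeomSum g⁻¹ fun k => AdMatrix (g ^ (1 - k)) * G k where
  zero := by simp [hG.zero]
  add_one k := by
    have hs : ∀ k : ℤ, AdMatrix g * G k = G k + AdMatrix (g ^ k) - 1 := fun k => by
      induction k using Int.induction_on with
      | zero => simp [hG.zero]
      | succ k ih =>
        rw [hG.add_one, mul_add, ih, ← map_mul, ← zpow_one_add, add_comm 1]
        abel
      | pred k ih =>
        have h := hG.add_one (-(k : ℤ) - 1)
        rw [sub_add_cancel] at h
        rw [h, mul_add, ← map_mul, ← zpow_one_add, add_sub_cancel] at ih
        rw [← sub_eq_zero] at ih ⊢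
        rw [← ih]
        abel
    rw [hG.add_one, mul_add, ← map_mul, ← zpow_add, show 1 - (k + 1) + k = 0 by ring,
      show 1 - k = -k + 1 by ring, show 1 - (k + 1) = -k by ring, zpow_add_one, map_mul, mul_assoc,
      hs, zpow_zero, map_one, mul_sub, mul_add, ← map_mul, ← zpow_add, neg_add_cancel, zpow_zero,
      map_one, mul_one, inv_zpow', sub_add_cancel]

/-- The Fox matrix at a complex number `t`. -/
noncomputable def foxAt (a b : SL(2, ℂ)) (m : ℤ) (U W : Matrix (Fin 3) (Fin 3) ℂ) (t : ℂ) :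
    Matrix (Fin 3) (Fin 3) ℂ :=
  t • foxCoeffOne b U W + foxCoeffZero a b m U W + t⁻¹ • foxCoeffNegOne a b m U W

/-- The Fox matrix for the other generator at a complex number `t`. -/
noncomputable def foxAt' (a b : SL(2, ℂ)) (m n : ℤ) (U W : Matrix (Fin 3) (Fin 3) ℂ) (t : ℂ) :
    Matrix (Fin 3) (Fin 3) ℂ :=
  AdMatrix (wordEval a b m ^ n) - (1 - t • AdMatrix b) * W *
    (AdMatrix (b * a⁻¹) - t⁻¹ • AdMatrix ((b * a⁻¹) ^ m * a⁻¹ * (b * a⁻¹) ^ (-m))) * U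

variable {a b : SL(2, ℂ)} {m n : ℤ}

theorem foxAt_eq (U W : Matrix (Fin 3) (Fin 3) ℂ) {t : ℂ} (ht : t ≠ 0) :
    foxAt a b m U W t = (1 - t • AdMatrix b) * W *
      (1 - t⁻¹ • AdMatrix ((b * a⁻¹) ^ m * a⁻¹ * (b * a⁻¹) ^ (-m))) * U - 1 := by
  rw [foxAt, foxCoeffOne, foxCoeffZero, foxCoeffNegOne]
  simp only [sub_mul, mul_sub, smul_mul_assoc, mul_smul_comm, smul_smul, one_mul, mul_one,
    inv_mul_cancel₀ ht, one_smul, smul_neg, smul_sub]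
  abel

theorem wordEval_mul_inv :
    wordEval a b m = (b * a⁻¹) ^ m * a⁻¹ * (b * a⁻¹) ^ (-m) * a := by
  simp only [wordEval, mul_assoc]

theorem foxAt_mul_add (hrel : wordEval a b m ^ n * a = b * wordEval a b m ^ n)
    (hu : (b * a⁻¹).1.trace ^ 2 - 4 ≠ 0) (hw : (wordEval a b m).1.trace ^ 2 - 4 ≠ 0)
    {t : ℂ} (ht : t ≠ 0) :
    foxAt a b m (geomAd (b * a⁻¹) m) (geomAd (wordEval a b m) n) t * (t • AdMatrix b - 1) +
      foxAt' a b m n (geomAd (b * a⁻¹) m) (geomAd (wordEval a b m) n) t *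
        (t • AdMatrix a - 1) = 0 := by
  have hU := (isGeomSum_geomAd _ hu).mul_sub_one m
  have hU' := geomAd_commute (b * a⁻¹) m 1
  have hW := (isGeomSum_geomAd _ hw).mul_sub_one n
  have hr := congrArg AdMatrix hrel
  have hb : AdMatrix b = AdMatrix (b * a⁻¹) * AdMatrix a := by
    rw [← map_mul, inv_mul_cancel_right]
  have hww : AdMatrix ((b * a⁻¹) ^ m * a⁻¹ * (b * a⁻¹) ^ (-m)) * AdMatrix a =
      AdMatrix (wordEval a b m) := by
    rw [← map_mul, wordEval_mul_inv]
  have hwm : AdMatrix ((b * a⁻¹) ^ m * a⁻¹ * (b * a⁻¹) ^ (-m)) *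
      (AdMatrix ((b * a⁻¹) ^ m) * AdMatrix a) = AdMatrix ((b * a⁻¹) ^ m) := by
    rw [← map_mul, ← map_mul]
    congr 1
    group
  rw [map_mul, map_mul] at hr
  rw [zpow_one] at hU'
  rw [foxAt_eq _ _ ht, foxAt']
  generalize geomAd (b * a⁻¹) m = U at *
  generalize geomAd (wordEval a b m) n = W at *
  generalize AdMatrix ((b * a⁻¹) ^ m * a⁻¹ * (b * a⁻¹) ^ (-m)) = Y at *
  generalize AdMatrix (wordEval a b m ^ n) = q at *
  generalize AdMatrix (wordEval a b m) = w at *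
  generalize AdMatrix ((b * a⁻¹) ^ m) = p at *
  generalize AdMatrix (b * a⁻¹) = u at *
  generalize AdMatrix a = A at *
  generalize AdMatrix b = B at *
  have hUu : U * u = U + p - 1 := by
    rw [mul_sub, mul_one, sub_eq_iff_eq_add] at hU
    rw [hU]
    abel
  have hUB : U * B = U * A + p * A - A := by
    rw [hb, ← mul_assoc, hUu, sub_mul, add_mul, one_mul]
  have hbr : (1 - t⁻¹ • Y) * U * (t • B - 1) - (u - t⁻¹ • Y) * U * (t • A - 1) = w - 1 := by
    rw [mul_assoc, mul_assoc, mul_sub U, mul_sub U, mul_smul_comm, mul_smul_comm, hUB, sub_mul u,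
      mul_sub u, mul_smul_comm, ← mul_assoc u, hU', hUu]
    simp only [sub_mul, add_mul, mul_sub, mul_add, smul_mul_assoc, mul_smul_comm, one_mul, mul_one,
      hww, hwm, hU', hUu, smul_sub, smul_add, smul_smul, mul_inv_cancel₀ ht, one_smul]
    abel
  have hring : ∀ F G G' E E' : Matrix (Fin 3) (Fin 3) ℂ,
      (F * W * G * U - 1) * E + (q - F * W * G' * U) * E' =
        F * W * (G * U * E - G' * U * E') - E + q * E' := fun F G G' E E' => by noncomm_ring
  calc _ = (1 - t • B) * W * ((1 - t⁻¹ • Y) * U * (t • B - 1) - (u - t⁻¹ • Y) * U * (t • A - 1))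
        - (t • B - 1) + q * (t • A - 1) := hring _ _ _ _ _
    _ = 0 := by
      rw [hbr, mul_assoc, hW, mul_sub q, mul_smul_comm, hr]
      simp only [sub_mul, mul_sub, smul_mul_assoc, one_mul, mul_one]
      abel

theorem det_foxAt' (hrel : wordEval a b m ^ n * a = b * wordEval a b m ^ n)
    (hu : (b * a⁻¹).1.trace ^ 2 - 4 ≠ 0) (hw : (wordEval a b m).1.trace ^ 2 - 4 ≠ 0)
    {t : ℂ} (ht : t ≠ 0) (hd : (t • AdMatrix a - 1).det ≠ 0)
    (hab : (t • AdMatrix b - 1).det = (t • AdMatrix a - 1).det) :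
    (foxAt' a b m n (geomAd (b * a⁻¹) m) (geomAd (wordEval a b m) n) t).det =
      -(foxAt a b m (geomAd (b * a⁻¹) m) (geomAd (wordEval a b m) n) t).det := by
  have h := congrArg Matrix.det (eq_neg_of_add_eq_zero_left (foxAt_mul_add hrel hu hw ht))
  rw [Matrix.det_mul, Matrix.det_neg, Matrix.det_mul, hab, Fintype.card_fin] at h
  apply mul_right_cancel₀ hd
  linear_combination h

theorem conj_foxAt_inv (hrel : wordEval a b m ^ n * a = b * wordEval a b m ^ n)
    (hu : (b * a⁻¹).1.trace ^ 2 - 4 ≠ 0) (hw : (wordEval a b m).1.trace ^ 2 - 4 ≠ 0)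
    (c : SL(2, ℂ)) (hca : c * a * c⁻¹ = b⁻¹) (hcb : c * b * c⁻¹ = a⁻¹) {t : ℂ} (ht : t ≠ 0) :
    AdMatrix (a * c) * foxAt a b m (geomAd (b * a⁻¹) m) (geomAd (wordEval a b m) n) t⁻¹ *
      AdMatrix (a * c)⁻¹ = -(AdMatrix (wordEval a b m ^ (-n)) *
        foxAt' a b m n (geomAd (b * a⁻¹) m) (geomAd (wordEval a b m) n) t) := by
  have hcu : c * (b * a⁻¹) * c⁻¹ = a⁻¹ * (b * a⁻¹) * a⁻¹⁻¹ := by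
    rw [show c * (b * a⁻¹) * c⁻¹ = c * b * c⁻¹ * (c * a * c⁻¹)⁻¹ by group, hca, hcb]
    group
  have hcum : ∀ k : ℤ, c * (b * a⁻¹) ^ k * c⁻¹ = a⁻¹ * (b * a⁻¹) ^ k * a := fun k => by
    rw [← conj_zpow, hcu, conj_zpow, inv_inv]
  have hcY : a * c * ((b * a⁻¹) ^ m * a⁻¹ * (b * a⁻¹) ^ (-m)) * (a * c)⁻¹ =
      (b * a⁻¹) ^ m * a * b * a⁻¹ * (b * a⁻¹) ^ (-m) := by
    rw [show a * c * ((b * a⁻¹) ^ m * a⁻¹ * (b * a⁻¹) ^ (-m)) * (a * c)⁻¹ =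
      a * ((c * (b * a⁻¹) ^ m * c⁻¹) * (c * a * c⁻¹)⁻¹ * (c * (b * a⁻¹) ^ (-m) * c⁻¹)) * a⁻¹ by
        group, hcum, hcum, hca]
    group
  have hcw : c * wordEval a b m * c⁻¹ = (wordEval a b m)⁻¹ := by
    rw [wordEval_mul_inv, show c * ((b * a⁻¹) ^ m * a⁻¹ * (b * a⁻¹) ^ (-m) * a) * c⁻¹ =
      (c * (b * a⁻¹) ^ m * c⁻¹) * (c * a * c⁻¹)⁻¹ * (c * (b * a⁻¹) ^ (-m) * c⁻¹) * (c * a * c⁻¹) by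
        group, hcum, hcum, hca]
    have hc : (b * a⁻¹) * (b * a⁻¹) ^ (-m) * (b * a⁻¹)⁻¹ = (b * a⁻¹) ^ (-m) := by
      generalize b * a⁻¹ = u
      group
    rw [show a⁻¹ * (b * a⁻¹) ^ m * a * b⁻¹⁻¹ * (a⁻¹ * (b * a⁻¹) ^ (-m) * a) * b⁻¹ =
      a⁻¹ * (b * a⁻¹) ^ m * a * ((b * a⁻¹) * (b * a⁻¹) ^ (-m) * (b * a⁻¹)⁻¹) by
        simp only [mul_inv_rev, inv_inv, mul_assoc], hc, zpow_neg]
    simp only [mul_inv_rev, inv_inv, mul_assoc]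
  have hU := (isGeomSum_geomAd _ hu).conj c
  have hU' := (isGeomSum_geomAd _ hu).conj a⁻¹
  rw [hcu] at hU
  have hUm := hU.unique hU' m
  have hW := (isGeomSum_geomAd _ hw).conj c
  rw [hcw] at hW
  have hWn := hW.unique (isGeomSum_geomAd _ hw).inv n
  have hWc := geomAd_commute (wordEval a b m) n 1
  rw [zpow_one] at hWc
  have hF2 : AdMatrix a * AdMatrix (wordEval a b m ^ (-n)) =
      AdMatrix (wordEval a b m ^ (-n)) * AdMatrix b := by
    rw [← map_mul, ← map_mul, zpow_neg, mul_inv_eq_iff_eq_mul.2]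
    rw [mul_assoc, ← hrel, inv_mul_cancel_left]
  have hF3 : AdMatrix (wordEval a b m) * AdMatrix a⁻¹ =
      AdMatrix ((b * a⁻¹) ^ m * a⁻¹ * (b * a⁻¹) ^ (-m)) := by
    rw [← map_mul, wordEval_mul_inv, mul_inv_cancel_right]
  have hF4 : AdMatrix ((b * a⁻¹) ^ m * a⁻¹ * (b * a⁻¹) ^ (-m)) *
      AdMatrix ((b * a⁻¹) ^ m * a * b * a⁻¹ * (b * a⁻¹) ^ (-m)) = AdMatrix (b * a⁻¹) := by
    rw [← map_mul]
    congr 1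
    have hc : (b * a⁻¹) ^ m * (b * a⁻¹) * ((b * a⁻¹) ^ m)⁻¹ = b * a⁻¹ := by
      generalize b * a⁻¹ = u
      group
    rw [zpow_neg]
    simpa only [mul_assoc, inv_mul_cancel_left] using hc
  have hq : AdMatrix (wordEval a b m ^ (-n)) * AdMatrix (wordEval a b m ^ n) = 1 := by
    rw [← map_mul, ← zpow_add, neg_add_cancel, zpow_zero, map_one]
  have hκ : ∀ X Y, AdMatrix (a * c) * (X * Y) * AdMatrix (a * c)⁻¹ =
      (AdMatrix (a * c) * X * AdMatrix (a * c)⁻¹) *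
        (AdMatrix (a * c) * Y * AdMatrix (a * c)⁻¹) := fun X Y => by
    rw [← mul_assoc (AdMatrix (a * c) * X * _), mul_assoc (AdMatrix (a * c) * X),
      ← mul_assoc (AdMatrix (a * c)⁻¹), AdMatrix_inv_mul, one_mul]
    simp only [mul_assoc]
  have hκs : ∀ (s : ℂ) X, AdMatrix (a * c) * (1 - s • X) * AdMatrix (a * c)⁻¹ =
      1 - s • (AdMatrix (a * c) * X * AdMatrix (a * c)⁻¹) := fun s X => by
    rw [mul_sub, sub_mul, mul_one, AdMatrix_mul_inv, mul_smul_comm, smul_mul_assoc]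
  have hκB : AdMatrix (a * c) * AdMatrix b * AdMatrix (a * c)⁻¹ = AdMatrix a⁻¹ := by
    rw [← map_mul, ← map_mul, show a * c * b * (a * c)⁻¹ = a * (c * b * c⁻¹) * a⁻¹ by group, hcb,
      mul_inv_cancel, one_mul]
  have hκY := congrArg AdMatrix hcY
  rw [map_mul, map_mul] at hκY
  have hκU : AdMatrix (a * c) * geomAd (b * a⁻¹) m * AdMatrix (a * c)⁻¹ = geomAd (b * a⁻¹) m := by
    rw [mul_inv_rev, map_mul, map_mul, mul_assoc (AdMatrix a), mul_assoc (AdMatrix a),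
      ← mul_assoc (_ * _) (AdMatrix c⁻¹), hUm,
      inv_inv]
    simp only [← mul_assoc, AdMatrix_mul_inv, one_mul]
    rw [mul_assoc, AdMatrix_mul_inv, mul_one]
  have hκW : AdMatrix (a * c) * geomAd (wordEval a b m) n * AdMatrix (a * c)⁻¹ =
      AdMatrix a * AdMatrix (wordEval a b m ^ (-n)) * geomAd (wordEval a b m) n *
        (AdMatrix (wordEval a b m) * AdMatrix a⁻¹) := by
    rw [mul_inv_rev, map_mul, map_mul, mul_assoc (AdMatrix a), mul_assoc (AdMatrix a),
      ← mul_assoc (_ * _) (AdMatrix c⁻¹), hWn,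
      show 1 - n = -n + 1 by ring, zpow_add_one, map_mul]
    simp only [mul_assoc]
    rw [← mul_assoc (AdMatrix (wordEval a b m)) (geomAd _ _), hWc]
    simp only [mul_assoc]
  rw [foxAt_eq _ _ (inv_ne_zero ht), inv_inv, mul_sub, sub_mul, mul_one, AdMatrix_mul_inv, hκ, hκ,
    hκ, hκU, hκW, hκs, hκs, hκB, hκY, foxAt', mul_sub _ (AdMatrix _), hq, hF3]
  have hA := AdMatrix_inv_mul a
  generalize geomAd (b * a⁻¹) m = U at *
  generalize geomAd (wordEval a b m) n = W at *
  generalize AdMatrix ((b * a⁻¹) ^ m * a⁻¹ * (b * a⁻¹) ^ (-m)) = Y at *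
  generalize AdMatrix ((b * a⁻¹) ^ m * a * b * a⁻¹ * (b * a⁻¹) ^ (-m)) = Z at *
  generalize AdMatrix (wordEval a b m ^ (-n)) = q at *
  generalize AdMatrix (b * a⁻¹) = u at *
  generalize AdMatrix a⁻¹ = A' at *
  generalize AdMatrix a = A at *
  generalize AdMatrix b = B at *
  have hL : (1 - t⁻¹ • A') * (A * q * W * Y) * (1 - t • Z) * U =
      ((1 - t⁻¹ • A') * (A * q)) * W * (Y * (1 - t • Z)) * U := by
    simp only [mul_assoc]
  have h1 : (1 - t⁻¹ • A') * (A * q) = -(t⁻¹ • (q * (1 - t • B))) := by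
    rw [← mul_assoc, sub_mul, one_mul, smul_mul_assoc, hA, sub_mul, hF2, smul_mul_assoc, one_mul,
      mul_sub, mul_one, mul_smul_comm, smul_sub, smul_smul, inv_mul_cancel₀ ht, one_smul]
    abel
  have h2 : Y * (1 - t • Z) = -(t • (u - t⁻¹ • Y)) := by
    rw [mul_sub, mul_one, mul_smul_comm, hF4, smul_sub, smul_smul, mul_inv_cancel₀ ht, one_smul]
    abel
  rw [hL, h1, h2]
  simp only [neg_mul, mul_neg, neg_neg, smul_neg, smul_mul_assoc, mul_smul_comm, smul_smul,
    mul_inv_cancel₀ ht, one_smul, mul_assoc]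
  abel

theorem adMat_mul_self (X : Matrix (Fin 2) (Fin 2) ℂ) : adMat X * adMat X =
    !![(X 0 0 - X 1 1) ^ 2 + 2 * X 0 1 * X 1 0, -2 * X 0 1 * (X 0 0 - X 1 1), -2 * X 0 1 ^ 2;
      -X 1 0 * (X 0 0 - X 1 1), 4 * X 0 1 * X 1 0, X 0 1 * (X 1 1 - X 0 0);
      -2 * X 1 0 ^ 2, 2 * X 1 0 * (X 1 1 - X 0 0), (X 0 0 - X 1 1) ^ 2 + 2 * X 0 1 * X 1 0] := by
  ext i j
  fin_cases i <;> fin_cases j <;> simp [adMat, Matrix.mul_apply, Fin.sum_univ_three] <;> ring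

/-! ### Representations in Riley normal form -/

/-- The pair `(a, b)` is in Riley normal form with parameters `s` and `y`. -/
structure IsRiley (a b : SL(2, ℂ)) (s y : ℂ) : Prop where
  ne_zero : s ≠ 0
  fst : a.1 = !![s, 1; 0, s⁻¹]
  snd : b.1 = !![s, 0; 2 - y, s⁻¹]

namespace IsRiley

variable {a b : SL(2, ℂ)} {s y : ℂ} (h : IsRiley a b s y)
include h

theorem trace_fst : a.1.trace = s + s⁻¹ := by
  rw [h.fst, Matrix.trace_fin_two_of]

theorem mul_inv_eq : (b * a⁻¹).1 = !![1, -s; (2 - y) * s⁻¹, y - 1] := by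
  have := h.ne_zero
  rw [Matrix.SpecialLinearGroup.coe_mul, Matrix.SpecialLinearGroup.coe_inv, h.fst, h.snd,
    Matrix.adjugate_fin_two_of]
  ext i j
  fin_cases i <;> fin_cases j <;> simp [this]
  ring

theorem trace_mul_inv : (b * a⁻¹).1.trace = y := by
  rw [h.mul_inv_eq, Matrix.trace_fin_two_of]
  ring

theorem zpow_eq (m : ℤ) : ((b * a⁻¹) ^ m).1 =
    !![chebS (m - 1) y - chebS (m - 2) y, -(s * chebS (m - 1) y);
      (2 - y) * s⁻¹ * chebS (m - 1) y, (y - 1) * chebS (m - 1) y - chebS (m - 2) y] := by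
  rw [SL2_zpow, h.trace_mul_inv, h.mul_inv_eq]
  ext i j
  fin_cases i <;> fin_cases j <;> simp <;> ring

theorem wordEval_eq (m : ℤ) : (wordEval a b m).1 = chebS (m - 1) y •
    !![(2 - y) * (s ^ 2 * chebS (m - 1) y - chebS (m - 2) y),
        (s - s⁻¹) * chebS (m - 2) y + (s + s⁻¹ - s * y) * chebS (m - 1) y;
      (2 - y) * ((s - s⁻¹) * chebS (m - 2) y + (s + s⁻¹ - s * y) * chebS (m - 1) y),
        (2 - y) * (chebS (m - 2) y + s⁻¹ ^ 2 * chebS (m - 1) y - y * chebS (m - 1) y)] -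
      (-1 : ℂ) • 1 := by
  have hs := h.ne_zero
  have hc := chebS_sq_add_sq m y
  rw [wordEval, zpow_neg]
  simp only [Matrix.SpecialLinearGroup.coe_mul, Matrix.SpecialLinearGroup.coe_inv]
  rw [h.zpow_eq, h.fst, Matrix.adjugate_fin_two_of, Matrix.adjugate_fin_two_of]
  generalize chebS (m - 1) y = S at *
  generalize chebS (m - 2) y = P at *
  ext i j
  fin_cases i <;> fin_cases j <;> simp <;> field_simp
  · linear_combination hc
  · ring
  · ring
  · linear_combination s ^ 2 * hc

theorem trace_wordEval (m : ℤ) : (wordEval a b m).1.trace =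
    2 + (y - 2) * (y + 2 - (s + s⁻¹) ^ 2) * chebS (m - 1) y ^ 2 := by
  have hs := h.ne_zero
  rw [h.wordEval_eq, Matrix.trace_sub, Matrix.trace_smul, Matrix.trace_smul,
    Matrix.trace_fin_two_of, Matrix.trace_one]
  simp
  field_simp
  ring

theorem wordEval_mul_sub (m : ℤ) : (wordEval a b m).1 * a.1 - b.1 * (wordEval a b m).1 =
    (1 - (y + 2 - (s + s⁻¹) ^ 2) * chebS (m - 1) y * (chebS (m - 1) y - chebS (m - 2) y)) •
      (a.1 - b.1) := by
  have hs := h.ne_zero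
  rw [h.wordEval_eq, h.fst, h.snd]
  generalize chebS (m - 1) y = S at *
  generalize chebS (m - 2) y = P at *
  ext i j
  rw [Matrix.sub_apply, Matrix.mul_apply, Matrix.mul_apply, Fin.sum_univ_two, Fin.sum_univ_two,
    Matrix.smul_apply, Matrix.sub_apply]
  fin_cases i <;> fin_cases j <;> simp <;> field_simp <;> ring

theorem trace_quad_mul_quad (m : ℤ) (c d e c' d' e' : ℂ) :
    (quad (adMat (b * a⁻¹).1) c d e * quad (adMat (wordEval a b m).1) c' d' e' *
      AdMatrix b⁻¹).trace = (s + s⁻¹) ^ 2 * (c - (y - 2) * d + y * (y - 2) * e) *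
        (c' - ((wordEval a b m).1.trace - 2) * d' + (wordEval a b m).1.trace *
          ((wordEval a b m).1.trace - 2) * e') - c * c' := by
  have hs := h.ne_zero
  have hc := chebS_sq_add_sq m y
  rw [h.trace_wordEval, h.wordEval_eq, adMat_smul_sub_smul_one, h.mul_inv_eq, AdMatrix_eq_of,
    Matrix.SpecialLinearGroup.coe_inv, h.snd, Matrix.adjugate_fin_two_of]
  generalize chebS (m - 1) y = S at *
  generalize chebS (m - 2) y = P at *
  simp only [quad, adMat_mul_self, add_mul, mul_add, smul_mul_assoc,
    mul_smul_comm, one_mul, mul_one, Matrix.trace_add, Matrix.trace_smul, smul_add]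
  simp only [adMat]
  simp [Matrix.trace_fin_three]
  linear_combination (norm := (field_simp; ring))
    (-2 * (s + s⁻¹) ^ 2 * (2 - y) * (y + 2 - (s + s⁻¹) ^ 2)) * S ^ 2 *
      (c + d * (2 - y) - e * y * (2 - y)) * e' * hc

end IsRiley

/-! ### The determinant of a matrix Laurent polynomial -/

theorem det_smul_add_smul_add {R : Type*} [CommRing R] (X Y Z : Matrix (Fin 3) (Fin 3) R)
    (p q : R) :
    (p • X + q • Y + Z).det = p ^ 3 * X.det + p ^ 2 * q * (X.adjugate * Y).trace +
      p ^ 2 * (X.adjugate * Z).trace + p * q ^ 2 * (Y.adjugate * X).trace +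
      q ^ 2 * (Y.adjugate * Z).trace + p * (Z.adjugate * X).trace + q * (Z.adjugate * Y).trace +
      q ^ 3 * Y.det + Z.det + p * q * ((X + Y + Z).det - (X + Y).det - (X + Z).det - (Y + Z).det +
        X.det + Y.det + Z.det) := by
  simp only [Matrix.adjugate_fin_three, Matrix.trace_fin_three, Matrix.mul_apply,
    Fin.sum_univ_three, Matrix.det_fin_three, Matrix.add_apply, Matrix.smul_apply, smul_eq_mul,
    Matrix.of_apply, Matrix.cons_val]
  ring

/-- The determinant of a quadratic matrix polynomial is a polynomial of degree at most six; three
of its coefficients are explicit. -/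
theorem exists_det_coeffs (X Y Z : Matrix (Fin 3) (Fin 3) ℂ) : ∃ c₁ c₂ c₃ c₄ : ℂ,
    ∀ (K : Type) [Field K] (φ : ℂ →+* K) (t : K),
      (t ^ 2 • φ.mapMatrix X + t • φ.mapMatrix Y + φ.mapMatrix Z).det =
        φ X.det * t ^ 6 + φ (X.adjugate * Y).trace * t ^ 5 + φ c₄ * t ^ 4 + φ c₃ * t ^ 3 +
          φ c₂ * t ^ 2 + φ c₁ * t + φ Z.det := by
  refine ⟨(Z.adjugate * Y).trace, (Y.adjugate * Z).trace + (Z.adjugate * X).trace,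
    Y.det + ((X + Y + Z).det - (X + Y).det - (X + Z).det - (Y + Z).det +
        X.det + Y.det + Z.det), (X.adjugate * Z).trace + (Y.adjugate * X).trace, ?_⟩
  intro K _ φ t
  have htr : ∀ M : Matrix (Fin 3) (Fin 3) ℂ, φ M.trace = (φ.mapMatrix M).trace := fun M => by
    simp [Matrix.trace_fin_three]
  rw [det_smul_add_smul_add]
  simp only [map_add, map_sub, RingHom.map_det, htr, map_mul, RingHom.map_adjugate]
  ring

theorem palindromic_coeffs {c₀ c₁ c₂ c₃ c₄ c₅ c₆ q : ℂ}
    (h : ∀ t : ℂ, t ≠ 0 → (t - 1) * (t ^ 2 - q * t + 1) ≠ 0 →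
      c₆ * t ^ 6 + c₅ * t ^ 5 + c₄ * t ^ 4 + c₃ * t ^ 3 + c₂ * t ^ 2 + c₁ * t + c₀ =
      c₀ * t ^ 6 + c₁ * t ^ 5 + c₂ * t ^ 4 + c₃ * t ^ 3 + c₄ * t ^ 2 + c₅ * t + c₆) :
    c₀ = c₆ ∧ c₁ = c₅ ∧ c₂ = c₄ := by
  open Polynomial in
  let P : ℂ[X] := C (c₆ - c₀) * (X ^ 6 - 1) + C (c₅ - c₁) * (X ^ 5 - X) +
    C (c₄ - c₂) * (X ^ 4 - X ^ 2)
  let Q : ℂ[X] := X * ((X - 1) * (X ^ 2 - C q * X + 1))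
  have hPQ : P * Q = 0 := by
    refine Polynomial.funext fun t => ?_
    rw [eval_mul, eval_zero, mul_eq_zero]
    by_cases h0 : t = 0
    · right
      simp [Q, h0]
    by_cases h1 : (t - 1) * (t ^ 2 - q * t + 1) = 0
    · right
      simp only [Q, eval_mul, eval_sub, eval_add, eval_X, eval_one, eval_pow, eval_C, h1, mul_zero]
    · left
      have := h t h0 h1
      simp only [P, eval_mul, eval_sub, eval_add, eval_X, eval_one, eval_pow, eval_C]
      linear_combination this
  have hQ : Q ≠ 0 := by
    refine mul_ne_zero X_ne_zero (mul_ne_zero (X_sub_C_ne_zero 1) fun h0 => ?_)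
    have := congrArg (eval 0) h0
    simp at this
  have hP : P = 0 := (mul_eq_zero.1 hPQ).resolve_right hQ
  have e0 := congrArg (fun p => coeff p 0) hP
  have e1 := congrArg (fun p => coeff p 1) hP
  have e2 := congrArg (fun p => coeff p 2) hP
  simp only [P, coeff_add, coeff_sub, coeff_C_mul, coeff_X_pow, coeff_X, coeff_one, coeff_zero]
    at e0 e1 e2
  norm_num at e0 e1 e2
  exact ⟨by linear_combination e0, by linear_combination e1, by linear_combination e2⟩

theorem sextic_eq {K : Type*} [Field K] {c₃ c₄ c₅ c₆ q ε σ : K} (hσ : σ ≠ 0)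
    (hq : σ ^ 2 - q * σ + 1 = 0) (h5 : c₅ = -c₆ * (ε + q + 2))
    (h1 : 2 * c₆ + 2 * c₅ + 2 * c₄ + c₃ = 0)
    (h2 : c₆ * (σ ^ 4 + 1) + (c₅ + 2 * c₆) * (σ ^ 3 + σ) + (c₄ + 2 * c₅ + 3 * c₆) * σ ^ 2 = 0) :
    c₄ = c₆ * (2 + q * ε) - 2 * c₅ - 3 * c₆ ∧
      c₃ = -2 * c₆ * (2 + q * ε) + 2 * c₅ + 4 * c₆ := by
  have h4 : c₄ = c₆ * (2 + q * ε) - 2 * c₅ - 3 * c₆ := by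
    apply mul_right_cancel₀ (pow_ne_zero 2 hσ)
    subst h5
    linear_combination h2 - c₆ * (σ ^ 2 - ε * σ + 1) * hq
  refine ⟨h4, ?_⟩
  linear_combination h1 - 2 * h4

theorem det_AdMatrix (g : SL(2, ℂ)) : (AdMatrix g).det = 1 := by
  rw [AdMatrix_eq_quad, det_quad_adMat, g.2]
  ring

theorem trace_AdMatrix (g : SL(2, ℂ)) : (AdMatrix g).trace = g.1.trace ^ 2 - 1 := by
  have h := g.2
  rw [Matrix.det_fin_two] at h
  rw [AdMatrix_eq_of]
  simp only [Matrix.trace_fin_three, Matrix.trace_fin_two, Matrix.of_apply, Matrix.cons_val]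
  linear_combination -h

theorem det_smul_AdMatrix_sub_one (g : SL(2, ℂ)) (t : ℂ) :
    (t • AdMatrix g - 1).det = (t - 1) * (t ^ 2 - (g.1.trace ^ 2 - 2) * t + 1) := by
  have h : t • AdMatrix g - 1 =
      quad (adMat g.1) (t - 1) (t * (g.1.trace / 2)) (t * (1 / 2)) := by
    rw [AdMatrix_eq_quad]
    simp only [quad]
    module
  rw [h, det_quad_adMat, g.2]
  ring

theorem trace_inv (g : SL(2, ℂ)) : (g⁻¹).1.trace = g.1.trace := by
  rw [SL2_inv, Matrix.trace_sub, Matrix.trace_smul, Matrix.trace_one]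
  simp
  ring

theorem trace_conj (c g : SL(2, ℂ)) : (c * g * c⁻¹).1.trace = g.1.trace := by
  rw [Matrix.SpecialLinearGroup.coe_mul, Matrix.trace_mul_comm,
    ← Matrix.SpecialLinearGroup.coe_mul, inv_mul_cancel_left]

variable {a b : SL(2, ℂ)} {m n : ℤ}

/-- The second highest coefficient of the determinant of the Fox matrix. -/
theorem trace_adjugate_foxCoeffOne_mul (hm : m ≠ 0) (hn : n ≠ 0)
    (hab : b.1.trace = a.1.trace)
    (hu : (b * a⁻¹).1.trace ^ 2 - 4 ≠ 0) (hw : (wordEval a b m).1.trace ^ 2 - 4 ≠ 0) {σ κ : ℂ}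
    (hσ : chebS (m - 2) (b * a⁻¹).1.trace = σ * chebS (m - 1) (b * a⁻¹).1.trace)
    (hκ : chebS (n - 2) (wordEval a b m).1.trace = κ * chebS (n - 1) (wordEval a b m).1.trace) :
    ((foxCoeffOne b (geomAd (b * a⁻¹) m) (geomAd (wordEval a b m) n)).adjugate *
      foxCoeffZero a b m (geomAd (b * a⁻¹) m) (geomAd (wordEval a b m) n)).trace =
      -(foxCoeffOne b (geomAd (b * a⁻¹) m) (geomAd (wordEval a b m) n)).det *
        (2 * a.1.trace ^ 2 - 2 - 1 / (m * n) * (geomAdInv (b * a⁻¹) m σ *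
          geomAdInv (wordEval a b m) n κ * AdMatrix b⁻¹).trace) := by
  have hm' : (m : ℂ) ≠ 0 := by exact_mod_cast hm
  have hn' : (n : ℂ) ≠ 0 := by exact_mod_cast hn
  have hU := geomAd_mul_geomAdInv _ hu m σ hσ
  have hW := geomAd_mul_geomAdInv _ hw n κ hκ
  have hWc : geomAdInv (wordEval a b m) n κ * geomAd (wordEval a b m) n = (n : ℂ) • 1 := by
    rw [← hW]
    exact quad_commute _ _ _ _ _ _ _
  have hB := AdMatrix_mul_inv b
  have hB' := AdMatrix_inv_mul b
  have htB : (AdMatrix b⁻¹).trace = a.1.trace ^ 2 - 1 := by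
    rw [trace_AdMatrix, trace_inv, hab]
  have htY : (AdMatrix ((b * a⁻¹) ^ m * a⁻¹ * (b * a⁻¹) ^ (-m))).trace = a.1.trace ^ 2 - 1 := by
    rw [trace_AdMatrix, zpow_neg, trace_conj, trace_inv]
  rw [foxCoeffOne, foxCoeffZero]
  generalize geomAd (b * a⁻¹) m = U at *
  generalize geomAd (wordEval a b m) n = W at *
  generalize AdMatrix ((b * a⁻¹) ^ m * a⁻¹ * (b * a⁻¹) ^ (-m)) = Y at *
  generalize geomAdInv (b * a⁻¹) m σ = Q at *
  generalize geomAdInv (wordEval a b m) n κ = R at *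
  generalize AdMatrix b⁻¹ = B' at *
  generalize AdMatrix b = B at *
  have hinv : -(B * W * U) * (Q * R * B') = -((m * n : ℂ) • (1 : Matrix (Fin 3) (Fin 3) ℂ)) := by
    rw [neg_mul, mul_assoc (B * W), ← mul_assoc U, ← mul_assoc U, hU, smul_mul_assoc, one_mul,
      smul_mul_assoc, mul_smul_comm, mul_assoc B, ← mul_assoc W, hW, smul_mul_assoc, one_mul,
      mul_smul_comm, hB, smul_smul]
  have hadj : (m * n : ℂ) • (-(B * W * U)).adjugate =
      -((-(B * W * U)).det • (Q * R * B')) := by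
    have h := congrArg (fun Z => (-(B * W * U)).adjugate * Z) hinv
    beta_reduce at h
    rw [← mul_assoc, Matrix.adjugate_mul, smul_mul_assoc, one_mul, mul_neg, mul_smul_comm,
      mul_one] at h
    rw [h, neg_neg]
  have ht1 : (Q * R * B' * (W * U)).trace = m * n * (a.1.trace ^ 2 - 1) := by
    rw [← mul_assoc, Matrix.trace_mul_comm]
    simp only [← mul_assoc]
    rw [hU, smul_mul_assoc, one_mul, smul_mul_assoc, smul_mul_assoc, Matrix.trace_smul,
      Matrix.trace_mul_comm, ← mul_assoc, hW, smul_mul_assoc, one_mul, Matrix.trace_smul, htB,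
      smul_eq_mul, smul_eq_mul]
    ring
  have ht2 : (Q * R * B' * (B * W * Y * U)).trace = m * n * (a.1.trace ^ 2 - 1) := by
    rw [mul_assoc (Q * R), mul_assoc (B * W), mul_assoc B, ← mul_assoc B', hB', one_mul,
      mul_assoc Q, ← mul_assoc R, hWc, smul_mul_assoc, one_mul, mul_smul_comm, Matrix.trace_smul,
      ← mul_assoc, Matrix.trace_mul_comm, ← mul_assoc, hU, smul_mul_assoc, one_mul,
      Matrix.trace_smul, htY, smul_eq_mul, smul_eq_mul]
    ring
  have h := congrArg (fun Z => (Z * (W * U + B * W * Y * U - 1)).trace) hadj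
  beta_reduce at h
  rw [smul_mul_assoc, Matrix.trace_smul, neg_mul, smul_mul_assoc, Matrix.trace_neg,
    Matrix.trace_smul, mul_sub (Q * R * B'), mul_add (Q * R * B'), mul_one, Matrix.trace_sub,
    Matrix.trace_add, ht1, ht2,
    smul_eq_mul, smul_eq_mul] at h
  apply mul_left_cancel₀ (mul_ne_zero hm' hn')
  rw [h]
  field_simp
  ring

theorem foxAt_det_mul (U W : Matrix (Fin 3) (Fin 3) ℂ) {t : ℂ} (ht : t ≠ 0) :
    t ^ 3 * (foxAt a b m U W t).det =
      (t ^ 2 • foxCoeffOne b U W + t • foxCoeffZero a b m U W + foxCoeffNegOne a b m U W).det := by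
  have h : t ^ 2 • foxCoeffOne b U W + t • foxCoeffZero a b m U W + foxCoeffNegOne a b m U W =
      t • foxAt a b m U W t := by
    rw [foxAt, smul_add, smul_add, smul_smul, smul_smul, mul_inv_cancel₀ ht, one_smul, sq]
  rw [h, Matrix.det_smul, Fintype.card_fin]

/-- If the Fox matrix kills a nonzero vector its determinant vanishes. -/
theorem det_foxAt_eq_zero (hrel : wordEval a b m ^ n * a = b * wordEval a b m ^ n)
    (hu : (b * a⁻¹).1.trace ^ 2 - 4 ≠ 0) (hw : (wordEval a b m).1.trace ^ 2 - 4 ≠ 0)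
    {t : ℂ} (ht : t ≠ 0) (v : Fin 3 → ℂ) (hA : (t • AdMatrix a - 1).mulVec v = 0)
    (hB : (t • AdMatrix b - 1).mulVec v ≠ 0) :
    (foxAt a b m (geomAd (b * a⁻¹) m) (geomAd (wordEval a b m) n) t).det = 0 := by
  refine Matrix.exists_mulVec_eq_zero_iff.1 ⟨_, hB, ?_⟩
  rw [Matrix.mulVec_mulVec, eq_neg_of_add_eq_zero_left (foxAt_mul_add hrel hu hw ht),
    Matrix.neg_mulVec, ← Matrix.mulVec_mulVec, hA, Matrix.mulVec_zero, neg_zero]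

theorem det_foxAt_inv (hrel : wordEval a b m ^ n * a = b * wordEval a b m ^ n)
    (hab : b.1.trace = a.1.trace)
    (hu : (b * a⁻¹).1.trace ^ 2 - 4 ≠ 0) (hw : (wordEval a b m).1.trace ^ 2 - 4 ≠ 0)
    (c : SL(2, ℂ)) (hca : c * a * c⁻¹ = b⁻¹) (hcb : c * b * c⁻¹ = a⁻¹) {t : ℂ} (ht : t ≠ 0)
    (hd : (t - 1) * (t ^ 2 - (a.1.trace ^ 2 - 2) * t + 1) ≠ 0) :
    (foxAt a b m (geomAd (b * a⁻¹) m) (geomAd (wordEval a b m) n) t⁻¹).det =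
      (foxAt a b m (geomAd (b * a⁻¹) m) (geomAd (wordEval a b m) n) t).det := by
  have h := congrArg Matrix.det (conj_foxAt_inv hrel hu hw c hca hcb ht)
  rw [Matrix.det_mul, Matrix.det_mul, det_AdMatrix, det_AdMatrix, Matrix.det_neg, Matrix.det_mul,
    det_AdMatrix, det_foxAt' hrel hu hw ht, Fintype.card_fin] at h
  · linear_combination h
  · rwa [det_smul_AdMatrix_sub_one]
  · rw [det_smul_AdMatrix_sub_one, det_smul_AdMatrix_sub_one, hab]

theorem continuousAt_foxAt (U W : Matrix (Fin 3) (Fin 3) ℂ) :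
    ContinuousAt (foxAt a b m U W) 1 := by
  unfold foxAt
  have h : ContinuousAt (fun t : ℂ => t⁻¹) 1 := continuousAt_inv₀ one_ne_zero
  fun_prop

theorem continuousAt_foxAt' (U W : Matrix (Fin 3) (Fin 3) ℂ) :
    ContinuousAt (foxAt' a b m n U W) 1 := by
  unfold foxAt'
  have h : ContinuousAt (fun t : ℂ => t⁻¹) 1 := continuousAt_inv₀ one_ne_zero
  fun_prop

/-- Evaluation of the middle coefficient in terms of Chebyshev polynomials. -/
theorem middle_coeff_eq (m n : ℤ) {x y σ κ z : ℂ} (hy : y + 2 ≠ 0) (hS : chebS (m - 1) y ≠ 0)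
    (hz : z = 2 + (y - 2) * (y + 2 - x ^ 2) * chebS (m - 1) y ^ 2) (hz2 : z + 2 ≠ 0)
    (hσ : σ = chebS (m - 2) y / chebS (m - 1) y)
    (hκ : κ = 1 - (y + 2 - x ^ 2) * chebS (m - 1) y * (chebS (m - 1) y - chebS (m - 2) y)) :
    m * n * (x ^ 2 - 2) - (x ^ 2 * ((2 + m * (y - 2 * σ)) / (y + 2)) *
      ((2 + n * (z - 2 * κ)) / (z + 2)) - 1) =
      (coeffA m n y * x ^ 4 + coeffB m n y * x ^ 2 + coeffC m n y) /
        (4 + (y - 2) * (y + 2 - x ^ 2) * chebS (m - 1) y ^ 2) := by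
  have hc := chebS_sq_add_sq m y
  have hM : chebS m y = y * chebS (m - 1) y - chebS (m - 2) y := by
    have h := chebS_sub_two m y
    linear_combination h
  have hz' : 4 + (y - 2) * (y + 2 - x ^ 2) * chebS (m - 1) y ^ 2 = z + 2 := by rw [hz]; ring
  rw [hz', coeffA, coeffB, coeffC, hM, hσ, hκ]
  generalize chebS (m - 1) y = S at *
  generalize chebS (m - 2) y = P at *
  field_simp
  rw [hz]
  linear_combination (-8*S + 16*S*m*n + -4*y*S + 8*y*S*m*n + -4*x^2*P*m + 4*x^2*S +
    -8*x^2*S*m*n + 2*x^2*y*S*m + -4*x^2*y*S*m*n + 4*x^4*S*m*n) * hc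

namespace IsRiley

variable {a b : SL(2, ℂ)} {s y : ℂ} {m n : ℤ} (h : IsRiley a b s y)
include h

theorem trace_snd : b.1.trace = a.1.trace := by
  rw [h.fst, h.snd, Matrix.trace_fin_two_of, Matrix.trace_fin_two_of]

theorem not_equal : a ≠ b := fun hab => by
  have h1 := congrArg (fun g : SL(2, ℂ) => g.1 0 1) hab
  simp [h.fst, h.snd] at h1

theorem chebS_ne_zero (hrel : wordEval a b m ^ n * a = b * wordEval a b m ^ n) :
    chebS (m - 1) y ≠ 0 := fun hS => by
  have hw : wordEval a b m = 1 := by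
    apply Subtype.ext
    rw [h.wordEval_eq, hS, zero_smul, zero_sub, neg_smul, one_smul, neg_neg]
    rfl
  rw [hw, one_zpow, one_mul, mul_one] at hrel
  exact h.not_equal hrel

/-- The Riley equation. -/
theorem riley_equation (hrel : wordEval a b m ^ n * a = b * wordEval a b m ^ n) :
    chebS (n - 2) (wordEval a b m).1.trace =
      (1 - (y + 2 - (s + s⁻¹) ^ 2) * chebS (m - 1) y * (chebS (m - 1) y - chebS (m - 2) y)) *
        chebS (n - 1) (wordEval a b m).1.trace := by
  have h1 := congrArg Subtype.val hrel
  rw [Matrix.SpecialLinearGroup.coe_mul, Matrix.SpecialLinearGroup.coe_mul, SL2_zpow, sub_mul,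
    mul_sub, smul_mul_assoc, smul_mul_assoc, mul_smul_comm, mul_smul_comm, one_mul, mul_one,
    sub_eq_sub_iff_sub_eq_sub, ← smul_sub, ← smul_sub, h.wordEval_mul_sub] at h1
  have h2 := congrFun (congrFun h1 0) 1
  simp [h.fst, h.snd] at h2
  linear_combination -h2

theorem chebS_sq_mul_chebS_sq (hrel : wordEval a b m ^ n * a = b * wordEval a b m ^ n) :
    chebS (m - 1) y ^ 2 * chebS (n - 1) (wordEval a b m).1.trace ^ 2 *
      ((y + 2 - (s + s⁻¹) ^ 2) * (4 - (s + s⁻¹) ^ 2 +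
        (y - 2) * (y + 2 - (s + s⁻¹) ^ 2) * chebS (m - 1) y ^ 2)) = 1 := by
  have hc := chebS_sq_add_sq m y
  have hd := chebS_sq_add_sq n (wordEval a b m).1.trace
  rw [h.riley_equation hrel] at hd
  have ht := h.trace_wordEval m
  generalize chebS (n - 1) (wordEval a b m).1.trace = T at *
  generalize (wordEval a b m).1.trace = z at *
  generalize chebS (m - 1) y = S at *
  generalize chebS (m - 2) y = P at *
  generalize s + s⁻¹ = x at *
  subst ht
  linear_combination hd - T ^ 2 * S ^ 2 * (y + 2 - x ^ 2) ^ 2 * hc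

theorem exists_conj (hy : y ≠ 2) : ∃ c : SL(2, ℂ), c * a * c⁻¹ = b⁻¹ ∧ c * b * c⁻¹ = a⁻¹ := by
  have hs := h.ne_zero
  obtain ⟨d, hd⟩ := IsAlgClosed.exists_pow_nat_eq (2 - y) (n := 2) (by norm_num)
  have hd0 : d ≠ 0 := by
    rintro rfl
    exact hy (by linear_combination hd)
  obtain ⟨c, hc⟩ : ∃ c : SL(2, ℂ), c.1 = !![0, d⁻¹; d⁻¹ * (y - 2), 0] := by
    refine ⟨⟨!![0, d⁻¹; d⁻¹ * (y - 2), 0], ?_⟩, rfl⟩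
    rw [Matrix.det_fin_two_of]
    field_simp
    linear_combination -hd
  refine ⟨c, ?_, ?_⟩
  all_goals
    rw [mul_inv_eq_iff_eq_mul]
    apply Subtype.ext
    rw [Matrix.SpecialLinearGroup.coe_mul, Matrix.SpecialLinearGroup.coe_mul,
      Matrix.SpecialLinearGroup.coe_inv, hc, h.fst, h.snd, Matrix.adjugate_fin_two_of]
    ext i j
    fin_cases i <;> fin_cases j <;> simp <;> field_simp <;> ring

theorem AdMatrix_fst : AdMatrix a = !![s ^ 2, -2 * s, -1; 0, 1, s⁻¹; 0, 0, s⁻¹ ^ 2] := by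
  rw [AdMatrix_eq_of, h.fst]
  ext i j
  fin_cases i <;> fin_cases j <;> simp [h.ne_zero]

theorem AdMatrix_snd : AdMatrix b = !![s ^ 2, 0, 0; -(s * (2 - y)), 1, 0;
    -(2 - y) ^ 2, 2 * (2 - y) * s⁻¹, s⁻¹ ^ 2] := by
  rw [AdMatrix_eq_of, h.snd]
  ext i j
  fin_cases i <;> fin_cases j <;> simp [h.ne_zero]

theorem det_foxAt_one (hrel : wordEval a b m ^ n * a = b * wordEval a b m ^ n) (hy : y ≠ 2)
    (hu : (b * a⁻¹).1.trace ^ 2 - 4 ≠ 0) (hw : (wordEval a b m).1.trace ^ 2 - 4 ≠ 0) :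
    (foxAt a b m (geomAd (b * a⁻¹) m) (geomAd (wordEval a b m) n) 1).det = 0 := by
  have hs := h.ne_zero
  refine det_foxAt_eq_zero hrel hu hw one_ne_zero ![1, (s - s⁻¹) / 2, 0] ?_ fun h0 => ?_
  · rw [one_smul, Matrix.sub_mulVec, Matrix.one_mulVec, h.AdMatrix_fst]
    ext i
    fin_cases i <;> simp
    field_simp
    ring
  · rw [one_smul, Matrix.sub_mulVec, Matrix.one_mulVec, h.AdMatrix_snd] at h0
    have e0 := congrFun h0 0
    have e2 := congrFun h0 2
    simp at e0 e2
    have hs2 : s⁻¹ ^ 2 = 1 := by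
      rw [inv_pow, show s ^ 2 = 1 by linear_combination e0, inv_one]
    have hg : (y - 2) ^ 2 = 0 := by
      have hss : s⁻¹ * s = 1 := inv_mul_cancel₀ hs
      linear_combination -e2 + (2 - y) * hss - (2 - y) * hs2
    exact hy (by linear_combination pow_eq_zero_iff (two_ne_zero) |>.1 hg)

theorem det_foxAt_inv_sq (hrel : wordEval a b m ^ n * a = b * wordEval a b m ^ n) (hy : y ≠ 2)
    (hu : (b * a⁻¹).1.trace ^ 2 - 4 ≠ 0) (hw : (wordEval a b m).1.trace ^ 2 - 4 ≠ 0) :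
    (foxAt a b m (geomAd (b * a⁻¹) m) (geomAd (wordEval a b m) n) (s ^ 2)⁻¹).det = 0 := by
  have hs := h.ne_zero
  refine det_foxAt_eq_zero hrel hu hw (inv_ne_zero (pow_ne_zero 2 hs)) ![1, 0, 0] ?_ fun h0 => ?_
  · rw [Matrix.sub_mulVec, Matrix.one_mulVec, Matrix.smul_mulVec, h.AdMatrix_fst]
    ext i
    fin_cases i <;> simp [hs]
  · rw [Matrix.sub_mulVec, Matrix.one_mulVec, Matrix.smul_mulVec, h.AdMatrix_snd] at h0
    have e2 := congrFun h0 2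
    simp [hs] at e2
    exact hy (by linear_combination -e2)

/-- For parabolic meridians the determinant of the Fox matrix vanishes to third order at `1`. -/
theorem det_foxAt_parabolic (hrel : wordEval a b m ^ n * a = b * wordEval a b m ^ n) (hy : y ≠ 2)
    (hu : (b * a⁻¹).1.trace ^ 2 - 4 ≠ 0) (hw : (wordEval a b m).1.trace ^ 2 - 4 ≠ 0)
    (hs2 : s ^ 2 = 1) (r : ℂ → ℂ) (hr : Continuous r)
    (hf : ∀ t : ℂ, t ≠ 0 → t ^ 3 *
      (foxAt a b m (geomAd (b * a⁻¹) m) (geomAd (wordEval a b m) n) t).det =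
        (t - 1) ^ 2 * r t) : r 1 = 0 := by
  have hsi : s⁻¹ = s :=
    inv_eq_of_mul_eq_one_left (by linear_combination hs2)
  set M := foxAt a b m (geomAd (b * a⁻¹) m) (geomAd (wordEval a b m) n) with hM
  set M' := foxAt' a b m n (geomAd (b * a⁻¹) m) (geomAd (wordEval a b m) n) with hM'
  let v : ℂ → Fin 3 → ℂ := fun t => ![-t ^ 2 - t, -(t * s * (t - 1)), (t - 1) ^ 2]
  have hA : ∀ t, (t • AdMatrix a - 1).mulVec (v t) = (t - 1) ^ 3 • ![0, 0, 1] := fun t => by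
    rw [Matrix.sub_mulVec, Matrix.one_mulVec, Matrix.smul_mulVec, h.AdMatrix_fst, hsi]
    ext i
    fin_cases i <;> simp [v]
    · linear_combination (-t ^ 3 - t ^ 2 + 2 * t ^ 2 * (t - 1)) * hs2
    · ring
    · linear_combination t * (t - 1) ^ 2 * hs2
  let g : ℂ → ℂ := fun t => (t • AdMatrix b - 1).mulVec (v t) 2
  have hg : ∀ t, g t = t * ((2 - y) ^ 2 * (t ^ 2 + t) - 2 * (2 - y) * t * (t - 1) + (t - 1) ^ 2) -
      (t - 1) ^ 2 := fun t => by
    simp only [g]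
    rw [Matrix.sub_mulVec, Matrix.one_mulVec, Matrix.smul_mulVec, h.AdMatrix_snd, hsi]
    simp [v]
    linear_combination (-2 * (2 - y) * t ^ 2 * (t - 1) + t * (t - 1) ^ 2) * hs2
  let k : ℂ → ℂ := fun t => -((M t).adjugate.mulVec ((M' t).mulVec ![0, 0, 1]) 2)
  have hk : ∀ t : ℂ, t ≠ 0 → (M t).det * g t = (t - 1) ^ 3 * k t := fun t ht => by
    have h1 : (M t).mulVec ((t • AdMatrix b - 1).mulVec (v t)) =
        -((t - 1) ^ 3 • (M' t).mulVec ![0, 0, 1]) := by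
      rw [Matrix.mulVec_mulVec, eq_neg_of_add_eq_zero_left (foxAt_mul_add hrel hu hw ht),
        Matrix.neg_mulVec, ← Matrix.mulVec_mulVec, hA, Matrix.mulVec_smul]
    have h2 := congrFun (congrArg (M t).adjugate.mulVec h1) 2
    rw [Matrix.mulVec_mulVec, Matrix.adjugate_mul, Matrix.smul_mulVec, Matrix.one_mulVec,
      Matrix.mulVec_neg, Matrix.mulVec_smul] at h2
    simp only [Pi.smul_apply, Pi.neg_apply, smul_eq_mul] at h2
    rw [h2]
    simp only [k]
    ring
  have hcM : ContinuousAt M 1 := continuousAt_foxAt _ _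
  have hcM' : ContinuousAt M' 1 := continuousAt_foxAt' _ _
  have hck : ContinuousAt k 1 := by
    have h1 : ContinuousAt (fun t => (M t).adjugate) 1 :=
      (continuous_id.matrix_adjugate).continuousAt.comp hcM
    have h2 : ContinuousAt (fun t => ((M t).adjugate * M' t) 2 2) 1 := by
      have h3 : ContinuousAt (fun t => (M t).adjugate * M' t) 1 := h1.mul hcM'
      exact ((continuous_apply 2).comp (continuous_apply 2)).continuousAt.comp h3
    refine h2.neg.congr (Filter.Eventually.of_forall fun t => ?_)
    simp only [k, Matrix.mulVec_mulVec]
    simp [Matrix.mulVec, dotProduct, Fin.sum_univ_three]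
  have hcg : Continuous g := by
    have : g = fun t => t * ((2 - y) ^ 2 * (t ^ 2 + t) - 2 * (2 - y) * t * (t - 1) + (t - 1) ^ 2) -
      (t - 1) ^ 2 := funext hg
    rw [this]
    fun_prop
  have hev : ∀ᶠ t in 𝓝[≠] (1 : ℂ), r t * g t = t ^ 3 * ((t - 1) * k t) := by
    have h0 : ∀ᶠ t in 𝓝[≠] (1 : ℂ), t ≠ 0 :=
      nhdsWithin_le_nhds (isOpen_ne.mem_nhds one_ne_zero)
    filter_upwards [h0, self_mem_nhdsWithin] with t ht ht1
    have ht1' : (t - 1) ^ 2 ≠ 0 := pow_ne_zero 2 (sub_ne_zero.2 ht1)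
    apply mul_left_cancel₀ ht1'
    linear_combination t ^ 3 * hk t ht - g t * hf t ht
  have hlim := tendsto_nhds_unique_of_eventuallyEq
    (((hr.mul hcg).continuousAt (x := 1)).tendsto.mono_left nhdsWithin_le_nhds)
    ((((continuous_pow 3).continuousAt (x := (1 : ℂ))).mul
      (((continuous_id.sub continuous_const).continuousAt (x := (1 : ℂ))).mul
        hck)).tendsto.mono_left
        nhdsWithin_le_nhds) hev
  have h0 : r 1 * g 1 = 0 := by simpa using hlim
  refine (mul_eq_zero.1 h0).resolve_right ?_
  rw [hg]
  have h2 : (2 - y) ^ 2 ≠ 0 := pow_ne_zero 2 (sub_ne_zero.2 hy.symm)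
  intro h3
  exact h2 (by linear_combination h3 / 2)

end IsRiley

/-- The closed formula for the invariant, from a factorization of the determinant of the Fox
matrix. -/
theorem adjointTAP_eq_of_det {m n : ℤ} (ρ : KnotGroup m n →* SL(2, ℂ))
    (U W : ℤ → Matrix (Fin 3) (Fin 3) ℂ)
    (hU : IsGeomSum (ρ (meridB m n) * (ρ (meridA m n))⁻¹) U)
    (hW : IsGeomSum (wordEval (ρ (meridA m n)) (ρ (meridB m n)) m) W) {c F x E : ℂ}
    (hx : x = (ρ (meridA m n)).1.trace) (hcF : c * F = 1)
    (hdet : ((RatFunc.X ^ 2 : RatFunc ℂ) • constMat (foxCoeffOne (ρ (meridB m n)) (U m) (W n)) +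
        (RatFunc.X : RatFunc ℂ) •
          constMat (foxCoeffZero (ρ (meridA m n)) (ρ (meridB m n)) m (U m) (W n)) +
        constMat (foxCoeffNegOne (ρ (meridA m n)) (ρ (meridB m n)) m (U m) (W n))).det =
      -RatFunc.C c * (RatFunc.X - 1) ^ 2 * (RatFunc.X ^ 2 - RatFunc.C (x ^ 2 - 2) * RatFunc.X + 1) *
        (RatFunc.C ((m : ℂ) * n) * RatFunc.X ^ 2 - RatFunc.C E * RatFunc.X
          + RatFunc.C ((m : ℂ) * n))) (j : Fin 2) :
    adjointTAP m n ρ j = (-1) ^ (j : ℕ) * RatFunc.X ^ (3 * (-1) : ℤ) *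
      ((RatFunc.X - 1) / RatFunc.C F *
        (RatFunc.C ((m : ℂ) * n) * RatFunc.X ^ 2 - RatFunc.C E * RatFunc.X
          + RatFunc.C ((m : ℂ) * n))) := by
  have hX : (RatFunc.X : RatFunc ℂ) ≠ 0 := RatFunc.X_ne_zero
  have hne := det_one_sub_smul_ne_zero (x ^ 2 - 2)
  have hC : RatFunc.C c * RatFunc.C F = 1 := by rw [← map_mul, hcF, map_one]
  have hs : ∀ A B D : Matrix (Fin 3) (Fin 3) (RatFunc ℂ),
      ((RatFunc.X : RatFunc ℂ) • A + B + (RatFunc.X⁻¹ : RatFunc ℂ) • D).det =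
        (RatFunc.X ^ 3)⁻¹ *
          ((RatFunc.X ^ 2 : RatFunc ℂ) • A + (RatFunc.X : RatFunc ℂ) • B + D).det := fun A B D => by
    have h : (RatFunc.X ^ 2 : RatFunc ℂ) • A + (RatFunc.X : RatFunc ℂ) • B + D =
        (RatFunc.X : RatFunc ℂ) •
          ((RatFunc.X : RatFunc ℂ) • A + B + (RatFunc.X⁻¹ : RatFunc ℂ) • D) := by
      rw [smul_add, smul_add, smul_smul, smul_smul, mul_inv_cancel₀ hX, one_smul, sq]
    rw [h, Matrix.det_smul, Fintype.card_fin, inv_mul_cancel_left₀ (pow_ne_zero 3 hX)]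
  rw [adjointTAP_eq ρ U W hU hW, hs, hdet, ← hx, mul_assoc ((-1) ^ (j : ℕ)),
    show (3 * (-1) : ℤ) = -((3 : ℕ) : ℤ) by norm_num, zpow_neg, zpow_natCast]
  congr 1
  rw [mul_div_assoc]
  congr 1
  rw [div_eq_iff hne, eq_inv_of_mul_eq_one_left hC]
  generalize RatFunc.C (x ^ 2 - 2) = q
  rw [div_eq_mul_inv]
  ring

theorem geomAdInv_factor_eq {c v σ : ℂ} (hv : v ^ 2 - 4 ≠ 0) :
    1 - (v - 2) * -(c * σ / 2) + v * (v - 2) * ((c * (1 - σ * v / 2) - 1) / (v ^ 2 - 4)) =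
      (2 + c * (v - 2 * σ)) / (v + 2) := by
  have h : v + 2 ≠ 0 := fun h => hv (by linear_combination (v - 2) * h)
  field_simp
  ring

namespace IsRiley

variable {a b : SL(2, ℂ)} {s y : ℂ} {m n : ℤ} (h : IsRiley a b s y)
include h

theorem trace_sq_sub_four_ne_zero (hy : y ≠ 2) (hy2 : y + 2 ≠ 0) :
    (b * a⁻¹).1.trace ^ 2 - 4 ≠ 0 := by
  rw [h.trace_mul_inv, show y ^ 2 - 4 = (y - 2) * (y + 2) by ring]
  exact mul_ne_zero (sub_ne_zero.2 hy) hy2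

theorem trace_wordEval_sq_sub_four_ne_zero
    (hrel : wordEval a b m ^ n * a = b * wordEval a b m ^ n) (hy : y ≠ 2)
    (hD : 4 + (y - 2) * (y + 2 - (s + s⁻¹) ^ 2) * chebS (m - 1) y ^ 2 ≠ 0) :
    (wordEval a b m).1.trace ^ 2 - 4 ≠ 0 := by
  have hy2x := left_ne_zero_of_mul (right_ne_zero_of_mul_eq_one (h.chebS_sq_mul_chebS_sq hrel))
  have hS := h.chebS_ne_zero hrel
  rw [h.trace_wordEval, show ∀ c : ℂ, (2 + c) ^ 2 - 4 = c * (4 + c) by intro c; ring]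
  exact mul_ne_zero (mul_ne_zero (mul_ne_zero (sub_ne_zero.2 hy) hy2x) (pow_ne_zero 2 hS)) hD

/-- The determinant of the Fox matrix of a representation in Riley normal form. -/
theorem det_fox (hm : m ≠ 0) (hn : n ≠ 0)
    (hrel : wordEval a b m ^ n * a = b * wordEval a b m ^ n) (hy : y ≠ 2) (hy2 : y + 2 ≠ 0)
    (hD : 4 + (y - 2) * (y + 2 - (s + s⁻¹) ^ 2) * chebS (m - 1) y ^ 2 ≠ 0) :
    ∀ (K : Type) [Field K] (φ : ℂ →+* K) (t : K),
      (t ^ 2 • φ.mapMatrix (foxCoeffOne b (geomAd (b * a⁻¹) m) (geomAd (wordEval a b m) n)) +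
        t • φ.mapMatrix (foxCoeffZero a b m (geomAd (b * a⁻¹) m) (geomAd (wordEval a b m) n)) +
        φ.mapMatrix
          (foxCoeffNegOne a b m (geomAd (b * a⁻¹) m) (geomAd (wordEval a b m) n))).det =
      -φ (chebS (m - 1) y ^ 2 * chebS (n - 1) (wordEval a b m).1.trace ^ 2) * (t - 1) ^ 2 *
        (t ^ 2 - φ ((s + s⁻¹) ^ 2 - 2) * t + 1) *
        (φ ((m : ℂ) * n) * t ^ 2 -
          φ ((coeffA m n y * (s + s⁻¹) ^ 4 + coeffB m n y * (s + s⁻¹) ^ 2 + coeffC m n y) /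
            (4 + (y - 2) * (y + 2 - (s + s⁻¹) ^ 2) * chebS (m - 1) y ^ 2)) * t +
          φ ((m : ℂ) * n)) := by
  have hs := h.ne_zero
  have hm' : (m : ℂ) ≠ 0 := by exact_mod_cast hm
  have hn' : (n : ℂ) ≠ 0 := by exact_mod_cast hn
  have hS := h.chebS_ne_zero hrel
  have hz := h.trace_wordEval m
  have hz2 : (wordEval a b m).1.trace + 2 ≠ 0 := fun h0 => hD (by linear_combination h0 - hz)
  have hu := h.trace_sq_sub_four_ne_zero hy hy2
  have hw := h.trace_wordEval_sq_sub_four_ne_zero hrel hy hD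
  have hκ := h.riley_equation hrel
  have hσ : chebS (m - 2) (b * a⁻¹).1.trace = chebS (m - 2) y / chebS (m - 1) y *
      chebS (m - 1) (b * a⁻¹).1.trace := by
    rw [h.trace_mul_inv, div_mul_cancel₀ _ hS]
  have hc5 := trace_adjugate_foxCoeffOne_mul hm hn h.trace_snd hu hw hσ hκ
  have hc6 : (foxCoeffOne b (geomAd (b * a⁻¹) m) (geomAd (wordEval a b m) n)).det =
      -(m * chebS (m - 1) y ^ 2 * (n * chebS (n - 1) (wordEval a b m).1.trace ^ 2)) := by
    rw [foxCoeffOne, Matrix.det_neg, Matrix.det_mul, Matrix.det_mul, det_AdMatrix,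
      det_geomAd _ hu, det_geomAd _ hw, h.trace_mul_inv, Fintype.card_fin]
    ring
  have hmid := middle_coeff_eq m n hy2 hS hz hz2 rfl rfl
  rw [geomAdInv, geomAdInv, h.trace_quad_mul_quad, geomAdInv_factor_eq hw, h.trace_fst,
    h.trace_mul_inv, geomAdInv_factor_eq (by rwa [h.trace_mul_inv] at hu)] at hc5
  obtain ⟨c₁, c₂, c₃, c₄, hc⟩ := exists_det_coeffs
    (foxCoeffOne b (geomAd (b * a⁻¹) m) (geomAd (wordEval a b m) n))
    (foxCoeffZero a b m (geomAd (b * a⁻¹) m) (geomAd (wordEval a b m) n))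
    (foxCoeffNegOne a b m (geomAd (b * a⁻¹) m) (geomAd (wordEval a b m) n))
  have hf : ∀ t : ℂ, t ≠ 0 → _ := fun t ht => (foxAt_det_mul (a := a) (b := b) (m := m)
    (geomAd (b * a⁻¹) m) (geomAd (wordEval a b m) n) ht).trans (hc ℂ (RingHom.id ℂ) t)
  simp only [RingHom.id_apply] at hf
  obtain ⟨c, hca, hcb⟩ := h.exists_conj hy
  have hinv := fun t => det_foxAt_inv (t := t) hrel h.trace_snd hu hw c hca hcb
  have hone := h.det_foxAt_one hrel hy hu hw
  have hsq := h.det_foxAt_inv_sq hrel hy hu hw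
  have hpar := h.det_foxAt_parabolic hrel hy hu hw
  generalize foxAt a b m (geomAd (b * a⁻¹) m) (geomAd (wordEval a b m) n) = M at *
  generalize foxCoeffOne b (geomAd (b * a⁻¹) m) (geomAd (wordEval a b m) n) = X₁ at *
  generalize foxCoeffZero a b m (geomAd (b * a⁻¹) m) (geomAd (wordEval a b m) n) = X₀ at *
  generalize foxCoeffNegOne a b m (geomAd (b * a⁻¹) m) (geomAd (wordEval a b m) n) = X' at *
  generalize (X₁.adjugate * X₀).trace = c₅ at *
  generalize hc6' : X₁.det = c₆ at *
  generalize X'.det = c₀ at *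
  generalize hE : (coeffA m n y * (s + s⁻¹) ^ 4 + coeffB m n y * (s + s⁻¹) ^ 2 + coeffC m n y) /
    (4 + (y - 2) * (y + 2 - (s + s⁻¹) ^ 2) * chebS (m - 1) y ^ 2) = E at *
  obtain ⟨h0, h1, h2⟩ := palindromic_coeffs (c₀ := c₀) (c₁ := c₁) (c₂ := c₂) (c₃ := c₃) (c₄ := c₄)
    (c₅ := c₅) (c₆ := c₆) (q := a.1.trace ^ 2 - 2) fun t ht htq => by
    have e1 := hf t ht
    have e2 := hf t⁻¹ (inv_ne_zero ht)
    rw [hinv t ht htq] at e2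
    have e3 : t ^ 6 * (t⁻¹ ^ 3 * (M t).det) = t ^ 3 * (M t).det := by
      field_simp
    rw [← e1, ← e3, e2]
    field_simp
    ring
  simp only [h0, h1, h2] at hf hc
  have hsum : 2 * c₆ + 2 * c₅ + 2 * c₄ + c₃ = 0 := by
    have e := hf 1 one_ne_zero
    rw [hone] at e
    linear_combination -e
  have hfac : ∀ t : ℂ, t ≠ 0 → t ^ 3 * (M t).det = (t - 1) ^ 2 * (c₆ * (t ^ 4 + 1) +
      (c₅ + 2 * c₆) * (t ^ 3 + t) + (c₄ + 2 * c₅ + 3 * c₆) * t ^ 2) := fun t ht => by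
    rw [hf t ht]
    linear_combination t ^ 3 * hsum
  have hroot : c₆ * (((s ^ 2)⁻¹) ^ 4 + 1) + (c₅ + 2 * c₆) * (((s ^ 2)⁻¹) ^ 3 + (s ^ 2)⁻¹) +
      (c₄ + 2 * c₅ + 3 * c₆) * ((s ^ 2)⁻¹) ^ 2 = 0 := by
    by_cases hs2 : s ^ 2 = 1
    · have e := hpar hs2 (fun t => c₆ * (t ^ 4 + 1) + (c₅ + 2 * c₆) * (t ^ 3 + t) +
        (c₄ + 2 * c₅ + 3 * c₆) * t ^ 2) (by fun_prop) hfac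
      rw [hs2, inv_one]
      exact e
    · have e := hfac _ (inv_ne_zero (pow_ne_zero 2 hs))
      rw [hsq, mul_zero, eq_comm, mul_eq_zero] at e
      refine e.resolve_left (pow_ne_zero 2 (sub_ne_zero.2 ?_))
      rwa [Ne, inv_eq_one]
  obtain ⟨h4, h3⟩ := sextic_eq (q := (s + s⁻¹) ^ 2 - 2) (ε := E / (m * n))
    (inv_ne_zero (pow_ne_zero 2 hs)) (by field_simp; ring) (by
      rw [hc5, ← hmid]
      field_simp
      ring) hsum hroot
  intro K _ φ t
  have hmn : (m : ℂ) * n ≠ 0 := mul_ne_zero hm' hn'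
  have hE' : φ (E / (m * n)) * φ (m * n) = φ E := by rw [← map_mul, div_mul_cancel₀ _ hmn]
  have hc6'' : φ c₆ = -φ (chebS (m - 1) y ^ 2 * chebS (n - 1) (wordEval a b m).1.trace ^ 2) *
      φ (m * n) := by
    rw [hc6, ← map_neg, ← map_mul]
    congr 1
    ring
  have h5 : c₅ = -c₆ * (E / (m * n) + ((s + s⁻¹) ^ 2 - 2) + 2) := by
    rw [hc5, ← hmid]
    field_simp
    ring
  rw [hc, h3, h4, h5, ← hE']
  generalize (s + s⁻¹) ^ 2 - 2 = q
  generalize E / (m * n) = ε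
  simp only [map_add, map_sub, map_mul φ c₆, map_mul φ (-c₆), map_mul φ 2, map_mul φ q,
    map_mul φ (-2 * c₆), map_mul φ (-2), map_mul φ 3, map_mul φ 4, map_neg, map_ofNat, hc6'']
  ring

end IsRiley

/-! ### Reducible representations -/

/-- `M` is upper triangular with diagonal entries `α`, `β`, `γ`. -/
def IsUpper {R : Type*} [Zero R] (M : Matrix (Fin 3) (Fin 3) R) (α β γ : R) : Prop :=
  ∃ x y z, M = !![α, x, y; 0, β, z; 0, 0, γ]

namespace IsUpper

variable {R : Type*} [CommRing R] {M N : Matrix (Fin 3) (Fin 3) R} {α β γ α' β' γ' : R}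

theorem add (hM : IsUpper M α β γ) (hN : IsUpper N α' β' γ') :
    IsUpper (M + N) (α + α') (β + β') (γ + γ') := by
  obtain ⟨x, y, z, rfl⟩ := hM
  obtain ⟨x', y', z', rfl⟩ := hN
  exact ⟨x + x', y + y', z + z', by ext i j; fin_cases i <;> fin_cases j <;> simp⟩

theorem mul (hM : IsUpper M α β γ) (hN : IsUpper N α' β' γ') :
    IsUpper (M * N) (α * α') (β * β') (γ * γ') := by
  obtain ⟨x, y, z, rfl⟩ := hM
  obtain ⟨x', y', z', rfl⟩ := hN
  exact ⟨α * x' + x * β', α * y' + x * z' + y * γ', β * z' + z * γ', by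
    ext i j; fin_cases i <;> fin_cases j <;> simp [Matrix.mul_apply, Fin.sum_univ_three]⟩

theorem smul (c : R) (hM : IsUpper M α β γ) : IsUpper (c • M) (c * α) (c * β) (c * γ) := by
  obtain ⟨x, y, z, rfl⟩ := hM
  exact ⟨c * x, c * y, c * z, by ext i j; fin_cases i <;> fin_cases j <;> simp⟩

theorem neg (hM : IsUpper M α β γ) : IsUpper (-M) (-α) (-β) (-γ) := by
  obtain ⟨x, y, z, rfl⟩ := hM
  exact ⟨-x, -y, -z, by ext i j; fin_cases i <;> fin_cases j <;> simp⟩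

theorem one : IsUpper (1 : Matrix (Fin 3) (Fin 3) R) 1 1 1 :=
  ⟨0, 0, 0, by ext i j; fin_cases i <;> fin_cases j <;> simp⟩

theorem map {K : Type*} [CommRing K] (φ : R →+* K) (hM : IsUpper M α β γ) :
    IsUpper (φ.mapMatrix M) (φ α) (φ β) (φ γ) := by
  obtain ⟨x, y, z, rfl⟩ := hM
  exact ⟨φ x, φ y, φ z, by ext i j; fin_cases i <;> fin_cases j <;> simp⟩

theorem det_eq (hM : IsUpper M α β γ) : M.det = α * β * γ := by
  obtain ⟨x, y, z, rfl⟩ := hM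
  simp [Matrix.det_fin_three]

end IsUpper

theorem isUpper_AdMatrix {g : SL(2, ℂ)} {s p : ℂ} (hs : s ≠ 0) (hg : g.1 = !![s, p; 0, s⁻¹]) :
    IsUpper (AdMatrix g) (s ^ 2) 1 (s⁻¹ ^ 2) := by
  refine ⟨-2 * s * p, -p ^ 2, p * s⁻¹, ?_⟩
  rw [AdMatrix_eq_of, hg]
  ext i j
  fin_cases i <;> fin_cases j <;> simp [hs]

theorem isUpper_quad {g : SL(2, ℂ)} {p : ℂ} (hg : g.1 = !![1, p; 0, 1]) (c d e : ℂ) :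
    IsUpper (quad (adMat g.1) c d e) c c c := by
  refine ⟨-2 * p * d, -2 * p ^ 2 * e, p * d, ?_⟩
  rw [quad, adMat_mul_self, adMat, hg]
  ext i j
  fin_cases i <;> fin_cases j <;> simp <;> ring

theorem unipotent_zpow {g : SL(2, ℂ)} {p : ℂ} (hg : g.1 = !![1, p; 0, 1]) (k : ℤ) :
    (g ^ k).1 = !![1, k * p; 0, 1] := by
  have ht : g.1.trace = 2 := by
    rw [hg, Matrix.trace_fin_two_of]
    norm_num
  rw [SL2_zpow, ht, chebS_two, chebS_two, hg]
  ext i j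
  fin_cases i <;> fin_cases j <;> simp
  all_goals ring

section

variable {a b : SL(2, ℂ)} {s p q : ℂ} {m n : ℤ} (hs : s ≠ 0) (ha : a.1 = !![s, p; 0, s⁻¹])
  (hb : b.1 = !![s, q; 0, s⁻¹])
include hs ha hb

theorem mul_inv_eq_of_upper : (b * a⁻¹).1 = !![1, s * (q - p); 0, 1] := by
  rw [Matrix.SpecialLinearGroup.coe_mul, Matrix.SpecialLinearGroup.coe_inv, ha, hb,
    Matrix.adjugate_fin_two_of]
  ext i j
  fin_cases i <;> fin_cases j <;> simp [hs]
  ring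

theorem wordEval_eq_of_upper :
    (wordEval a b m).1 = !![1, m * (q - p) * (s - s⁻¹); 0, 1] := by
  have hu := unipotent_zpow (mul_inv_eq_of_upper hs ha hb)
  rw [wordEval]
  simp only [Matrix.SpecialLinearGroup.coe_mul, Matrix.SpecialLinearGroup.coe_inv]
  rw [hu, hu, ha, Matrix.adjugate_fin_two_of]
  ext i j
  fin_cases i <;> fin_cases j <;> simp [hs]
  field_simp
  ring

/-- The condition on the meridian eigenvalue of a nonabelian reducible representation. -/
theorem mul_sub_inv_sq_of_upper (hrel : wordEval a b m ^ n * a = b * wordEval a b m ^ n)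
    (hab : a ≠ b) : (m : ℂ) * n * (s - s⁻¹) ^ 2 = -1 := by
  have hpq : q - p ≠ 0 := fun h0 => hab <| Subtype.ext <| by
    rw [ha, hb, sub_eq_zero.1 h0]
  have h := congrFun (congrFun (congrArg Subtype.val hrel) 0) 1
  rw [Matrix.SpecialLinearGroup.coe_mul, Matrix.SpecialLinearGroup.coe_mul,
    unipotent_zpow (wordEval_eq_of_upper hs ha hb), ha, hb] at h
  simp at h
  apply mul_left_cancel₀ hpq
  linear_combination -h

/-- The determinant of the Fox matrix of a reducible representation. -/
theorem det_fox_of_upper (hrel : wordEval a b m ^ n * a = b * wordEval a b m ^ n) (hab : a ≠ b)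
    {K : Type*} [Field K] (φ : ℂ →+* K) (t : K) (d e d' e' : ℂ) :
    (t ^ 2 • φ.mapMatrix (foxCoeffOne b (quad (adMat (b * a⁻¹).1) m d e)
          (quad (adMat (wordEval a b m).1) n d' e')) +
        t • φ.mapMatrix (foxCoeffZero a b m (quad (adMat (b * a⁻¹).1) m d e)
          (quad (adMat (wordEval a b m).1) n d' e')) +
        φ.mapMatrix (foxCoeffNegOne a b m (quad (adMat (b * a⁻¹).1) m d e)
          (quad (adMat (wordEval a b m).1) n d' e'))).det =
      -φ ((m * n) ^ 2) * (t - 1) ^ 2 * (t ^ 2 - φ ((s + s⁻¹) ^ 2 - 2) * t + 1) *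
        (φ ((m : ℂ) * n) * t ^ 2 - φ ((m : ℂ) * n * (s ^ 4 + s⁻¹ ^ 4)) * t +
          φ ((m : ℂ) * n)) := by
  have hN := mul_sub_inv_sq_of_upper hs ha hb hrel hab
  have hu := mul_inv_eq_of_upper hs ha hb
  have hU := isUpper_quad hu m d e
  have hW := isUpper_quad (wordEval_eq_of_upper (m := m) hs ha hb) n d' e'
  have hB := isUpper_AdMatrix hs hb
  have hY : IsUpper (AdMatrix ((b * a⁻¹) ^ m * a⁻¹ * (b * a⁻¹) ^ (-m)))
      (1 ^ 2 * s⁻¹ ^ 2 * 1 ^ 2) (1 * 1 * 1) (1⁻¹ ^ 2 * s⁻¹⁻¹ ^ 2 * 1⁻¹ ^ 2) := by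
    have h1 : ∀ k : ℤ, IsUpper (AdMatrix ((b * a⁻¹) ^ k)) (1 ^ 2) 1 (1⁻¹ ^ 2) := fun k =>
      isUpper_AdMatrix (p := k * (s * (q - p))) one_ne_zero (by rw [unipotent_zpow hu, inv_one])
    rw [map_mul, map_mul]
    refine ((h1 m).mul (isUpper_AdMatrix (p := -p) (inv_ne_zero hs) ?_)).mul (h1 (-m))
    rw [Matrix.SpecialLinearGroup.coe_inv, ha, Matrix.adjugate_fin_two_of, inv_inv, neg_zero]
  have h := (((((hB.mul hW).mul hU).neg.map φ).smul (t ^ 2)).add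
    (((((hW.mul hU).add (((hB.mul hW).mul hY).mul hU)).add IsUpper.one.neg).map φ).smul t)).add
    (((hW.mul hY).mul hU).neg.map φ)
  rw [← sub_eq_add_neg] at h
  rw [foxCoeffOne, foxCoeffZero, foxCoeffNegOne, h.det_eq]
  have hs' : φ s * φ s⁻¹ = 1 := by rw [← map_mul, mul_inv_cancel₀ hs, map_one]
  have hN' : φ m * φ n * (φ s - φ s⁻¹) ^ 2 = -1 := by
    rw [← map_sub, ← map_pow, ← map_mul, ← map_mul, hN, map_neg, map_one]
  simp only [map_add, map_sub, map_mul, map_neg, map_pow, map_one, inv_inv, inv_one, map_ofNat,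
    one_pow, mul_one, one_mul]
  generalize φ s⁻¹ = r at *
  generalize φ s = s at *
  generalize φ m = m at *
  generalize φ n = n at *
  have e1 : t ^ 2 * -(s ^ 2 * n * m) + t * (n * m + s ^ 2 * n * r ^ 2 * m + -1) + -(n * r ^ 2 * m)
      = -(m * n) * s ^ 2 * (t - 1) * (t - r ^ 4) := by
    linear_combination -t * hN' +
      m * n * (t * (s * r - 1 - r ^ 2 * (s * r + 1)) + r ^ 2 * (s * r + 1)) * hs'
  have e2 : t ^ 2 * -(n * m) + t * (n * m + n * m + -1) + -(n * m)
      = -(m * n) * (t ^ 2 - ((s + r) ^ 2 - 2) * t + 1) := by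
    linear_combination -t * hN' - 4 * m * n * t * hs'
  have e3 : t ^ 2 * -(r ^ 2 * n * m) + t * (n * m + r ^ 2 * n * s ^ 2 * m + -1) + -(n * s ^ 2 * m)
      = -(m * n) * r ^ 2 * (t - 1) * (t - s ^ 4) := by
    linear_combination -t * hN' +
      m * n * (t * (s * r - 1 - s ^ 2 * (s * r + 1)) + s ^ 2 * (s * r + 1)) * hs'
  rw [e1, e2, e3]
  linear_combination -(m * n) ^ 3 * (t - 1) ^ 2 * (t ^ 2 - ((s + r) ^ 2 - 2) * t + 1) *
    ((t ^ 2 - (s ^ 4 + r ^ 4) * t) * (s * r + 1) + 1 + s * r + (s * r) ^ 2 + (s * r) ^ 3 +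
      (s * r) ^ 4 + (s * r) ^ 5) * hs'

end

/-- The middle coefficient of a reducible representation. -/
theorem middle_coeff_eq_of_upper {s : ℂ} {m n : ℤ} (hs : s ≠ 0) (hm : m ≠ 0)
    (hN : (m : ℂ) * n * (s - s⁻¹) ^ 2 = -1) :
    (coeffA m n 2 * (s + s⁻¹) ^ 4 + coeffB m n 2 * (s + s⁻¹) ^ 2 + coeffC m n 2) /
      (4 + (2 - 2) * (2 + 2 - (s + s⁻¹) ^ 2) * chebS (m - 1) 2 ^ 2) =
        (m : ℂ) * n * (s ^ 4 + s⁻¹ ^ 4) := by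
  have hm' : (m : ℂ) ≠ 0 := by exact_mod_cast hm
  have hA : coeffA m n 2 = 2 * m * n := by
    rw [coeffA, chebS_two, chebS_two]
    push_cast
    ring
  have hB : coeffB m n 2 = -2 - 4 * m * n := by
    rw [coeffB, chebS_two, chebS_two]
    push_cast
    rw [sub_add_cancel]
    field_simp
    ring
  have hC : coeffC m n 2 = -4 * (2 * m * n - 1) := by
    rw [coeffC, chebS_two, chebS_two]
    push_cast
    ring
  have hsr : s * s⁻¹ = 1 := mul_inv_cancel₀ hs
  rw [hA, hB, hC, sub_self, zero_mul, zero_mul, add_zero, div_eq_iff (by norm_num)]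
  generalize s⁻¹ = r at *
  linear_combination (-2 * (s + r) ^ 2 + 4) * hN +
    8 * m * n * (r ^ 2 + s ^ 2 + s * r + 1) * hsr

/-- An upper triangular conjugate of the meridians has equal diagonals. -/
theorem upper_diag_eq {a b : SL(2, ℂ)} {m n : ℤ} (ha : a.1 1 0 = 0) (hb : b.1 1 0 = 0)
    (hrel : wordEval a b m ^ n * a = b * wordEval a b m ^ n) : a.1 0 0 = b.1 0 0 := by
  have hmul : ∀ g h : SL(2, ℂ), g.1 1 0 = 0 → h.1 1 0 = 0 → (g * h).1 1 0 = 0 := fun g h hg hh => by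
    rw [Matrix.SpecialLinearGroup.coe_mul, Matrix.mul_apply, Fin.sum_univ_two, hg, hh]
    ring
  have hzpow : ∀ (g : SL(2, ℂ)) (k : ℤ), g.1 1 0 = 0 → (g ^ k).1 1 0 = 0 := fun g k hg => by
    rw [SL2_zpow]
    simp [hg]
  have hinv : ∀ g : SL(2, ℂ), g.1 1 0 = 0 → (g⁻¹).1 1 0 = 0 := fun g hg => by
    rw [SL2_inv]
    simp [hg]
  have hu := hmul _ _ hb (hinv _ ha)
  have hw : (wordEval a b m ^ n).1 1 0 = 0 :=
    hzpow _ _ (hmul _ _ (hzpow _ _ hu) (hmul _ _ (hmul _ _ (hinv _ ha) (hzpow _ _ hu)) ha))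
  have h0 : (wordEval a b m ^ n).1 0 0 ≠ 0 := fun h0 => by
    have hd := (wordEval a b m ^ n).2
    rw [Matrix.det_fin_two, h0, hw] at hd
    simp at hd
  have h := congrFun (congrFun (congrArg Subtype.val hrel) 0) 0
  rw [Matrix.SpecialLinearGroup.coe_mul, Matrix.SpecialLinearGroup.coe_mul, Matrix.mul_apply,
    Matrix.mul_apply, Fin.sum_univ_two, Fin.sum_univ_two, ha, hw, mul_zero, mul_zero, add_zero,
    add_zero, mul_comm] at h
  exact mul_right_cancel₀ h0 h

theorem eq_upper {g : SL(2, ℂ)} (hg : g.1 1 0 = 0) :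
    g.1 0 0 ≠ 0 ∧ g.1 = !![g.1 0 0, g.1 0 1; 0, (g.1 0 0)⁻¹] := by
  have hd := g.2
  rw [Matrix.det_fin_two, hg, mul_zero, sub_zero] at hd
  refine ⟨left_ne_zero_of_mul_eq_one hd, ?_⟩
  rw [← eq_inv_of_mul_eq_one_right hd, ← hg]
  exact Matrix.eta_fin_two g.1

/-! ### Normal forms -/

/-- A matrix with an eigenvalue has an eigenvector. -/
theorem exists_eigenvector (g : SL(2, ℂ)) {s : ℂ} (hs : s ^ 2 - g.1.trace * s + 1 = 0) :
    ∃ v : Fin 2 → ℂ, v ≠ 0 ∧ g.1.mulVec v = s • v := by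
  have hd := g.2
  rw [Matrix.det_fin_two] at hd
  rw [Matrix.trace_fin_two] at hs
  have h : (g.1 - s • 1).det = 0 := by
    rw [Matrix.det_fin_two]
    simp
    linear_combination hd + hs
  obtain ⟨v, hv, h⟩ := Matrix.exists_mulVec_eq_zero_iff.2 h
  refine ⟨v, hv, ?_⟩
  rw [Matrix.sub_mulVec, Matrix.smul_mulVec, Matrix.one_mulVec] at h
  exact sub_eq_zero.1 h

theorem conj_apply_one_zero (g c : SL(2, ℂ)) {s : ℂ}
    (h : g.1.mulVec (fun i => c.1 i 0) = s • fun i => c.1 i 0) :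
    (c⁻¹ * g * c).1 1 0 = 0 ∧ (c⁻¹ * g * c).1 0 0 = s := by
  have hd := c.2
  rw [Matrix.det_fin_two] at hd
  have h0 := congrFun h 0
  have h1 := congrFun h 1
  simp [Matrix.mulVec, dotProduct, Fin.sum_univ_two] at h0 h1
  rw [Matrix.SpecialLinearGroup.coe_mul, Matrix.SpecialLinearGroup.coe_mul,
    Matrix.SpecialLinearGroup.coe_inv, Matrix.adjugate_fin_two]
  simp only [Matrix.mul_apply, Fin.sum_univ_two, Matrix.of_apply, Matrix.cons_val]
  constructor
  · simp
    linear_combination c.1 0 0 * h1 - c.1 1 0 * h0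
  · simp
    linear_combination c.1 1 1 * h0 - c.1 0 1 * h1 + s * hd

theorem conj_apply_zero_one (g c : SL(2, ℂ)) {s : ℂ}
    (h : g.1.mulVec (fun i => c.1 i 1) = s • fun i => c.1 i 1) :
    (c⁻¹ * g * c).1 0 1 = 0 ∧ (c⁻¹ * g * c).1 1 1 = s := by
  have hd := c.2
  rw [Matrix.det_fin_two] at hd
  have h0 := congrFun h 0
  have h1 := congrFun h 1
  simp [Matrix.mulVec, dotProduct, Fin.sum_univ_two] at h0 h1
  rw [Matrix.SpecialLinearGroup.coe_mul, Matrix.SpecialLinearGroup.coe_mul,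
    Matrix.SpecialLinearGroup.coe_inv, Matrix.adjugate_fin_two]
  simp only [Matrix.mul_apply, Fin.sum_univ_two, Matrix.of_apply, Matrix.cons_val]
  constructor
  · simp
    linear_combination c.1 1 1 * h0 - c.1 0 1 * h1
  · simp
    linear_combination c.1 0 0 * h1 - c.1 1 0 * h0 + s * hd

theorem exists_col_eq {v : Fin 2 → ℂ} (hv : v ≠ 0) : ∃ c : SL(2, ℂ), (fun i => c.1 i 0) = v := by
  by_cases h0 : v 0 = 0
  · have h1 : v 1 ≠ 0 := fun h1 => hv (by ext i; fin_cases i <;> assumption)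
    refine ⟨⟨!![v 0, -(v 1)⁻¹; v 1, 0], by rw [Matrix.det_fin_two_of]; field_simp; ring⟩, ?_⟩
    ext i
    fin_cases i <;> rfl
  · refine ⟨⟨!![v 0, 0; v 1, (v 0)⁻¹], by rw [Matrix.det_fin_two_of]; field_simp; ring⟩, ?_⟩
    ext i
    fin_cases i <;> rfl

/-- Two elements of `SL₂(ℂ)` with the same trace can be brought into upper triangular form or
into Riley normal form simultaneously. -/
theorem exists_normal_form (a b : SL(2, ℂ)) (hab : b.1.trace = a.1.trace) :
    ∃ c : SL(2, ℂ), ((c⁻¹ * a * c).1 1 0 = 0 ∧ (c⁻¹ * b * c).1 1 0 = 0) ∨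
      ∃ s y : ℂ, y ≠ 2 ∧ IsRiley (c⁻¹ * a * c) (c⁻¹ * b * c) s y := by
  obtain ⟨s, hs⟩ : ∃ s : ℂ, s ^ 2 - a.1.trace * s + 1 = 0 := by
    obtain ⟨d, hd⟩ := IsAlgClosed.exists_pow_nat_eq (a.1.trace ^ 2 - 4) (n := 2) (by norm_num)
    exact ⟨(a.1.trace + d) / 2, by linear_combination hd / 4⟩
  have hs0 : s ≠ 0 := by
    rintro rfl
    simp at hs
  have htr : a.1.trace = s + s⁻¹ := by
    field_simp
    linear_combination -hs
  obtain ⟨v, hv, hav⟩ := exists_eigenvector a hs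
  obtain ⟨v', hv', hbv⟩ := exists_eigenvector b (s := s⁻¹) (by
    rw [hab, htr]
    field_simp
    ring)
  by_cases hdet : v 0 * v' 1 - v' 0 * v 1 = 0
  · obtain ⟨c, hc⟩ := exists_col_eq hv
    have hk : ∃ k : ℂ, v = k • v' := by
      by_cases h0 : v' 0 = 0
      · have h1 : v' 1 ≠ 0 := fun h1 => hv' (by ext i; fin_cases i <;> assumption)
        have h2 : v 0 = 0 := by simpa [h0, h1] using hdet
        refine ⟨v 1 / v' 1, ?_⟩
        ext i
        fin_cases i <;> simp [h0, h1, h2]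
      · refine ⟨v 0 / v' 0, ?_⟩
        ext i
        fin_cases i
        · simp [h0]
        · simp
          field_simp
          linear_combination -hdet
    obtain ⟨k, hk⟩ := hk
    refine ⟨c, Or.inl ⟨(conj_apply_one_zero a c (s := s) (by rw [hc, hav])).1,
      (conj_apply_one_zero b c (s := s⁻¹) ?_).1⟩⟩
    rw [hc, hk, Matrix.mulVec_smul, hbv, smul_comm]
  obtain ⟨c, hc, hc'⟩ : ∃ c : SL(2, ℂ), (fun i => c.1 i 0) = v ∧
      (fun i => c.1 i 1) = (v 0 * v' 1 - v' 0 * v 1)⁻¹ • v' := by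
    refine ⟨⟨!![v 0, (v 0 * v' 1 - v' 0 * v 1)⁻¹ * v' 0; v 1, (v 0 * v' 1 - v' 0 * v 1)⁻¹ * v' 1],
      ?_⟩, ?_, ?_⟩
    · rw [Matrix.det_fin_two_of]
      linear_combination inv_mul_cancel₀ hdet
    all_goals
      ext i
      fin_cases i <;> rfl
  obtain ⟨ha10, ha00⟩ := conj_apply_one_zero a c (s := s) (by rw [hc, hav])
  obtain ⟨hb01, hb11⟩ := conj_apply_zero_one b c (s := s⁻¹) (by
    rw [hc', Matrix.mulVec_smul, hbv, smul_comm])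
  have hda := (c⁻¹ * a * c).2
  have hdb := (c⁻¹ * b * c).2
  have hcomp : ∀ d g : SL(2, ℂ), (c * d)⁻¹ * g * (c * d) = d⁻¹ * (c⁻¹ * g * c) * d := fun d g => by
    group
  rw [Matrix.det_fin_two, ha10, ha00, mul_zero, sub_zero] at hda
  rw [Matrix.det_fin_two, hb01, hb11, zero_mul, sub_zero] at hdb
  replace hda := eq_inv_of_mul_eq_one_right hda
  replace hdb := eq_inv_of_mul_eq_one_left hdb
  rw [inv_inv] at hdb
  have hA := Matrix.eta_fin_two (c⁻¹ * a * c).1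
  have hB := Matrix.eta_fin_two (c⁻¹ * b * c).1
  rw [ha10, ha00, hda] at hA
  rw [hb01, hb11, hdb] at hB
  by_cases hr : (c⁻¹ * b * c).1 1 0 = 0
  · exact ⟨c, Or.inl ⟨ha10, hr⟩⟩
  by_cases hp : (c⁻¹ * a * c).1 0 1 = 0
  · obtain ⟨d, hd⟩ : ∃ d : SL(2, ℂ), d.1 = !![0, -1; 1, 0] :=
      ⟨⟨!![0, -1; 1, 0], by rw [Matrix.det_fin_two_of]; ring⟩, rfl⟩
    refine ⟨c * d, Or.inl ?_⟩
    simp only [hcomp]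
    generalize c⁻¹ * a * c = a' at *
    generalize c⁻¹ * b * c = b' at *
    simp only [Matrix.SpecialLinearGroup.coe_mul, Matrix.SpecialLinearGroup.coe_inv]
    rw [hA, hB, hd, Matrix.adjugate_fin_two_of, hp]
    constructor <;> simp [Matrix.mul_apply, Fin.sum_univ_two]
  · obtain ⟨μ, hμ⟩ := IsAlgClosed.exists_pow_nat_eq ((c⁻¹ * a * c).1 0 1) (n := 2) (by norm_num)
    have hμ0 : μ ≠ 0 := by
      rintro rfl
      exact hp (by rw [← hμ]; norm_num)
    obtain ⟨d, hd⟩ : ∃ d : SL(2, ℂ), d.1 = !![μ, 0; 0, μ⁻¹] :=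
      ⟨⟨!![μ, 0; 0, μ⁻¹], by rw [Matrix.det_fin_two_of]; simp [hμ0]⟩, rfl⟩
    refine ⟨c * d, Or.inr ⟨s, 2 - (c⁻¹ * b * c).1 1 0 * μ ^ 2, ?_, ?_⟩⟩
    · intro h
      exact mul_ne_zero hr (pow_ne_zero 2 hμ0) (by linear_combination -h)
    simp only [hcomp]
    generalize c⁻¹ * a * c = a' at *
    generalize c⁻¹ * b * c = b' at *
    refine ⟨hs0, ?_, ?_⟩
    · rw [Matrix.SpecialLinearGroup.coe_mul, Matrix.SpecialLinearGroup.coe_mul,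
        Matrix.SpecialLinearGroup.coe_inv, hA, hd, Matrix.adjugate_fin_two_of, ← hμ]
      ext i j
      fin_cases i <;> fin_cases j <;> simp <;> field_simp
    · rw [Matrix.SpecialLinearGroup.coe_mul, Matrix.SpecialLinearGroup.coe_mul,
        Matrix.SpecialLinearGroup.coe_inv, hB, hd, Matrix.adjugate_fin_two_of]
      ext i j
      fin_cases i <;> fin_cases j <;> simp <;> field_simp

theorem adjointTAP_conj {m n : ℤ} (ρ ρ' : KnotGroup m n →* SL(2, ℂ)) (c : SL(2, ℂ))
    (h : ∀ g, ρ' g = c⁻¹ * ρ g * c) (j : Fin 2) : adjointTAP m n ρ j = adjointTAP m n ρ' j :=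
  (wada_conj _ _ _ _ (AdMatrix c⁻¹) (AdMatrix c) (AdMatrix_mul_inv c) (fun g => by
    rw [MonoidHom.comp_apply, MonoidHom.comp_apply, h, map_mul, map_mul]) j).symm

/-- A representation with commuting meridians is abelian. -/
theorem meridian_not_commute {m n : ℤ} (ρ : KnotGroup m n →* SL(2, ℂ))
    (hρ : ∃ g h : KnotGroup m n, ρ g * ρ h ≠ ρ h * ρ g) :
    ρ (meridA m n) ≠ ρ (meridB m n) := fun hab => by
  obtain ⟨g, h, hgh⟩ := hρ
  have key : ∀ g : KnotGroup m n, ρ g ∈ Subgroup.zpowers (ρ (meridA m n)) := fun g => by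
    obtain ⟨u, rfl⟩ := PresentedGroup.mk_surjective _ g
    induction u using FreeGroup.induction_on with
    | C1 => rw [map_one, map_one]; exact one_mem _
    | of i =>
      fin_cases i
      · exact Subgroup.mem_zpowers _
      · change ρ (meridB m n) ∈ _
        rw [← hab]
        exact Subgroup.mem_zpowers _
    | inv_of i ih => rw [map_inv, map_inv]; exact inv_mem ih
    | mul u v hu hv => rw [map_mul, map_mul]; exact mul_mem hu hv
  obtain ⟨i, hi⟩ := key g
  obtain ⟨j, hj⟩ := key h
  refine hgh ?_
  rw [← hi, ← hj]
  exact (Commute.refl _).zpow_zpow i j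

end TwistedAlexander

theorem theorem1p1 (m n : ℤ) (hm : m ≠ 0) (hn : n ≠ 0)
    (ρ : KnotGroup m n →* Matrix.SpecialLinearGroup (Fin 2) ℂ)
    (hρ : ∃ g h : KnotGroup m n, ρ g * ρ h ≠ ρ h * ρ g)
    (x y : ℂ)
    (hx : x = (ρ (meridA m n)).1.trace)
    (hy : y = (ρ (meridA m n * (meridB m n)⁻¹)).1.trace)
    (hy2 : y + 2 ≠ 0)
    (hD : 4 + (y - 2) * (y + 2 - x ^ 2) * chebS (m - 1) y ^ 2 ≠ 0) :
    chebS (m - 1) y ≠ 0 ∧ y + 2 - x ^ 2 ≠ 0 ∧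
    4 - x ^ 2 + (y - 2) * (y + 2 - x ^ 2) * chebS (m - 1) y ^ 2 ≠ 0 ∧
    ∃ k : ℤ, ∀ j : Fin 2,
      adjointTAP m n ρ j =
        (-1) ^ (j : ℕ) * RatFunc.X ^ (3 * k) *
          ((RatFunc.X - 1) /
              RatFunc.C ((y + 2 - x ^ 2) *
                (4 - x ^ 2 + (y - 2) * (y + 2 - x ^ 2) * chebS (m - 1) y ^ 2)) *
            (RatFunc.C ((m : ℂ) * n) * RatFunc.X ^ 2
              - RatFunc.C ((coeffA m n y * x ^ 4 + coeffB m n y * x ^ 2 + coeffC m n y) /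
                  (4 + (y - 2) * (y + 2 - x ^ 2) * chebS (m - 1) y ^ 2)) * RatFunc.X
              + RatFunc.C ((m : ℂ) * n))) := by
  have hm' : (m : ℂ) ≠ 0 := by exact_mod_cast hm
  have hab := meridian_not_commute ρ hρ
  obtain ⟨c, hc⟩ := exists_normal_form (ρ (meridA m n)) (ρ (meridB m n)) (trace_meridB ρ)
  obtain ⟨ρ', hρ'⟩ : ∃ ρ' : KnotGroup m n →* SL(2, ℂ), ∀ g, ρ' g = c⁻¹ * ρ g * c :=
    ⟨(MulAut.conj c⁻¹).toMonoidHom.comp ρ, fun g => by simp⟩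
  simp only [adjointTAP_conj ρ ρ' c hρ']
  rw [← hρ', ← hρ'] at hc
  have htr : ∀ g, (ρ' g).1.trace = (ρ g).1.trace := fun g => by
    have := trace_conj c⁻¹ (ρ g)
    rwa [inv_inv, ← hρ'] at this
  have hab' : ρ' (meridA m n) ≠ ρ' (meridB m n) := fun h0 => hab <| by
    rw [hρ', hρ'] at h0
    exact mul_left_cancel (mul_right_cancel h0)
  rw [← htr] at hx hy
  have hrel := rho_relation ρ'
  rw [map_mul, map_inv] at hy
  have hy' : (ρ' (meridB m n) * (ρ' (meridA m n))⁻¹).1.trace = y := by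
    rw [hy, ← trace_inv, mul_inv_rev, inv_inv]
  obtain ⟨ha, hb⟩ | ⟨s, y', hy0, h⟩ := hc
  · have hdiag := upper_diag_eq ha hb hrel
    obtain ⟨hs, ha⟩ := eq_upper ha
    obtain ⟨-, hb⟩ := eq_upper hb
    rw [← hdiag] at hb
    generalize (ρ' (meridA m n)).1 0 0 = s at *
    obtain rfl : y = 2 := by
      rw [← hy', mul_inv_eq_of_upper hs ha hb, Matrix.trace_fin_two_of]
      norm_num
    obtain rfl : x = s + s⁻¹ := by rw [hx, ha, Matrix.trace_fin_two_of]
    have hN := mul_sub_inv_sq_of_upper hs ha hb hrel hab'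
    have hxs : (2 : ℂ) + 2 - (s + s⁻¹) ^ 2 = -(s - s⁻¹) ^ 2 := by
      linear_combination -4 * mul_inv_cancel₀ hs
    have hx0 : (2 : ℂ) + 2 - (s + s⁻¹) ^ 2 ≠ 0 := fun h0 => by
      have : (m : ℂ) * n * (s - s⁻¹) ^ 2 = 0 := by linear_combination -(m * n : ℂ) * (h0 - hxs)
      rw [hN] at this
      norm_num at this
    have hx1 : 4 - (s + s⁻¹) ^ 2 + (2 - 2) * (2 + 2 - (s + s⁻¹) ^ 2) * chebS (m - 1) 2 ^ 2 =
        2 + 2 - (s + s⁻¹) ^ 2 := by ring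
    have hw : (wordEval (ρ' (meridA m n)) (ρ' (meridB m n)) m).1.trace = 2 := by
      rw [wordEval_eq_of_upper hs ha hb, Matrix.trace_fin_two_of]
      norm_num
    refine ⟨?_, hx0, by rwa [hx1], -1, adjointTAP_eq_of_det ρ' _ _
      (exists_isGeomSum_of_trace_eq_two _ hy') (exists_isGeomSum_of_trace_eq_two _ hw)
      (c := (m * n) ^ 2) hx ?_ ?_⟩
    · rw [chebS_two]
      push_cast
      rwa [sub_add_cancel]
    · rw [hx1, hxs]
      linear_combination (m * n * (s - s⁻¹) ^ 2 - 1) * hN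
    · rw [middle_coeff_eq_of_upper hs hm hN]
      exact det_fox_of_upper hs ha hb hrel hab' RatFunc.C RatFunc.X _ _ _ _
  · obtain rfl : y' = y := by rw [← h.trace_mul_inv, hy']
    obtain rfl : x = s + s⁻¹ := by rw [hx, h.trace_fst]
    have hST := h.chebS_sq_mul_chebS_sq hrel
    have hF := right_ne_zero_of_mul_eq_one hST
    exact ⟨h.chebS_ne_zero hrel, left_ne_zero_of_mul hF, right_ne_zero_of_mul hF, -1,
      adjointTAP_eq_of_det ρ' _ _ (isGeomSum_geomAd _ (h.trace_sq_sub_four_ne_zero hy0 hy2))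
        (isGeomSum_geomAd _ (h.trace_wordEval_sq_sub_four_ne_zero hrel hy0 hD)) hx hST
        (h.det_fox hm hn hrel hy0 hy2 hD _ RatFunc.C RatFunc.X)⟩
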